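/- Let $1\le k<n$ and let $A=D+UV^H\in\mathbb C^{n\times n}$ with $D$ unitary diagonal and $U,V\in\mathbb C^{n\times k}$. Let $E=[I_k,0]^T=e_1\otimes I_k\in\mathbb C^{n\times k}$, and partition rows and columns into consecutive groups of size $k$ (the last group may be smaller, in which case "triangular" means trapezoidal). Definitions. A unitary $G$ has *block CMV shape* with block size $k$ if its block pattern is $$G=\begin{bmatrix}\times&\times&L_3\\ R_1&\times&\times\\ &\times&\times&\times&L_5\\ &R_2&\times&\times&\times\\ &&&\times&\times&\ddots\\ &&&R_4&\times&\ddots\\ &&&&\ddots&\ddots\end{bmatrix}$$ with every $R_i$ upper triangular and every $L_i$ lower triangular; it is *block CMV* if in addition all $R_i,L_i$ have full rank (are nonsingular, when they are $k\times k$). A *CMV factorization shape* of $G$ is $G=G_1G_2$ with unitary block diagonal $G_1=\operatorname{diag}(G_{1,1},G_{1,2},\dots)$, $G_2=\operatorname{diag}(I_k,G_{2,2},G_{2,3},\dots)$, where all $G_{i,j}$ have size $2k$ (only the last one of $G_1$ and of $G_2$ may be truncated), their lower left $k\times k$ block is upper triangular and their upper right one is lower triangular; it is a *CMV factorization* if these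 triangular blocks have full rank. A triple $(L,F,R)$ is an *LFR representation* of a matrix $M$ if $M=LFR$, $L$ is a product of $k$ unitary lower Hessenberg matrices, $R$ is a product of $k$ unitary upper Hessenberg matrices, and $F=Q+EY^H$ with $Y\in\mathbb C^{n\times k}$ and $Q=\operatorname{diag}(I_k,\hat Q)$, $\hat Q$ unitary upper Hessenberg. The pair $(D,U)$ is *nondegenerate* if $U=WC$ for some $W\in\mathbb C^{n\times k}$, $C\in\mathbb C^{k\times k}$ with $\operatorname{rank}[W,DW,\dots,D^{m-1}W]=\min(n,mk)$ for all $m\ge0$ (if $\operatorname{rank}U=k$, this is the same condition for $W=U$). Theorem. 1. There are a unitary $P$, a matrix $U_1\in\mathbb C^{k\times k}$ and matrices $G_1,G_2$ such that $G=PD^HP^H$ has block CMV shape, $PU=EU_1$, $G=G_1G_2$ is a CMV factorization shape of $G$, and, with $Z^H=U_1(PV)^HG_1$, the matrix $PAP^H=G_2^H(I_n+EZ^H)G_1^H$ has the LFR representation $(L,F,R)=(G_2^H,\;I_n+EZ^H,\;G_1^H)$. 2. There are a unitary $P$ and $U_1\in\mathbb C^{k\times k}$ such that $G=PD^HP^H$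 is block CMV and $PU=EU_1$ if and only if $(D,U)$ is nondegenerate. 3. Whenever $P$ is unitary, $G=PD^HP^H$ is block CMV and $PU=EU_1$, then $G$ has a CMV factorization, and for each CMV factorization $G=G_1G_2$ the triple $(G_2^H,\;I_n+EZ^H,\;G_1^H)$ with $Z^H=U_1(PV)^HG_1$ is an LFR representation of $PAP^H$. -/

import Mathlib

open Matrix

/-- The `n × k` matrix `[I_k, 0]ᵀ = e₁ ⊗ I_k`. -/
def firstCols (n k : ℕ) : Matrix (Fin n) (Fin k) ℂ :=
  Matrix.of fun i j => if (i : ℕ) = (j : ℕ) then 1 else 0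

/-- The block of `M` in block position `(a, b)` (counted from `0`) when rows and columns are
partitioned into consecutive groups of size `k`; the last group may be smaller than `k`. -/
def kBlock {n : ℕ} (k : ℕ) (M : Matrix (Fin n) (Fin n) ℂ) (a b : ℕ) :
    Matrix {i : Fin n // (i : ℕ) / k = a} {j : Fin n // (j : ℕ) / k = b} ℂ :=
  M.submatrix Subtype.val Subtype.val

/-- The block `(a, b)` is upper triangular (upper trapezoidal, for a truncated block). -/
def UpperTriBlock {n : ℕ} (k : ℕ) (M : Matrix (Fin n) (Fin n) ℂ) (a b : ℕ) : Prop :=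
  ∀ i j, (j : Fin n).val % k < (i : Fin n).val % k → ∀ hi hj, kBlock k M a b ⟨i, hi⟩ ⟨j, hj⟩ = 0

/-- The block `(a, b)` is lower triangular (lower trapezoidal, for a truncated block). -/
def LowerTriBlock {n : ℕ} (k : ℕ) (M : Matrix (Fin n) (Fin n) ℂ) (a b : ℕ) : Prop :=
  ∀ i j, (i : Fin n).val % k < (j : Fin n).val % k → ∀ hi hj, kBlock k M a b ⟨i, hi⟩ ⟨j, hj⟩ = 0

/-- The block `(a, b)` has full rank; for a `k × k` block this says that it is nonsingular. -/
def FullRankBlock {n : ℕ} (k : ℕ) (M : Matrix (Fin n) (Fin n) ℂ) (a b : ℕ) : Prop :=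
  (kBlock k M a b).rank =
    min (Fintype.card {i : Fin n // (i : ℕ) / k = a}) (Fintype.card {j : Fin n // (j : ℕ) / k = b})

/-- Positions of the outermost lower blocks `R₁, R₂, R₄, R₆, …` of the block CMV pattern. -/
def IsRPos (a b : ℕ) : Prop := (a = 1 ∧ b = 0) ∨ ∃ p, a = 2 * p + 3 ∧ b = 2 * p + 1

/-- Positions of the outermost upper blocks `L₃, L₅, L₇, …` of the block CMV pattern. -/
def IsLPos (a b : ℕ) : Prop := ∃ p, a = 2 * p ∧ b = 2 * p + 2

/-- `G` is unitary, has the staircase block CMV pattern with block size `k`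
(block rows `0, 1` live in block columns `0, 1, 2`; block rows `2p, 2p + 1` with `p ≥ 1` live in
block columns `2p - 1, …, 2p + 2`), the blocks `R_i` are upper triangular and the blocks `L_i` are
lower triangular. The blocks `R_i`, `L_i` may be singular here. -/
structure HasBlockCMVShape {n : ℕ} (k : ℕ) (G : Matrix (Fin n) (Fin n) ℂ) : Prop where
  unitary : G ∈ unitaryGroup (Fin n) ℂ
  pattern : ∀ i j : Fin n, G i j ≠ 0 →
    2 * (((i : ℕ) / k) / 2) ≤ (j : ℕ) / k + 1 ∧ (j : ℕ) / k ≤ 2 * (((i : ℕ) / k) / 2) + 2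
  upper : ∀ a b, IsRPos a b → UpperTriBlock k G a b
  lower : ∀ a b, IsLPos a b → LowerTriBlock k G a b

/-- `G` is CMV structured with block size `k`: moreover, the `R_i`, `L_i` are nonsingular. -/
structure IsBlockCMV {n : ℕ} (k : ℕ) (G : Matrix (Fin n) (Fin n) ℂ) : Prop
    extends HasBlockCMVShape k G where
  fullRank_R : ∀ a b, IsRPos a b → FullRankBlock k G a b
  fullRank_L : ∀ a b, IsLPos a b → FullRankBlock k G a b

/-- `G = G₁ G₂` with unitary block diagonal `G₁ = diag(G₁₁, G₁₂, …)` and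
`G₂ = diag(I_k, G₂₂, G₂₃, …)`, where the `G_ij` have size `2k` (truncated at the end of the matrix)
and, in their partition into `k × k` blocks, an upper triangular lower left block and a lower
triangular upper right block (that is, they have bandwidth `k`). -/
structure HasCMVFactorShape {n : ℕ} (k : ℕ) (G G₁ G₂ : Matrix (Fin n) (Fin n) ℂ) : Prop where
  eq_mul : G = G₁ * G₂
  unitary₁ : G₁ ∈ unitaryGroup (Fin n) ℂ
  unitary₂ : G₂ ∈ unitaryGroup (Fin n) ℂ
  diag₁ : ∀ i j : Fin n, G₁ i j ≠ 0 → ((i : ℕ) / k) / 2 = ((j : ℕ) / k) / 2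
  diag₂ : ∀ i j : Fin n, G₂ i j ≠ 0 → ((i : ℕ) / k + 1) / 2 = ((j : ℕ) / k + 1) / 2
  head₂ : ∀ i j : Fin n, (i : ℕ) < k → (j : ℕ) < k → G₂ i j = (1 : Matrix (Fin n) (Fin n) ℂ) i j
  upper₁ : ∀ p, UpperTriBlock k G₁ (2 * p + 1) (2 * p)
  lower₁ : ∀ p, LowerTriBlock k G₁ (2 * p) (2 * p + 1)
  upper₂ : ∀ p, UpperTriBlock k G₂ (2 * p + 2) (2 * p + 1)
  lower₂ : ∀ p, LowerTriBlock k G₂ (2 * p + 1) (2 * p + 2)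

/-- The CMV factorization of `G`: moreover, these triangular blocks have full rank. -/
structure IsCMVFactorization {n : ℕ} (k : ℕ) (G G₁ G₂ : Matrix (Fin n) (Fin n) ℂ) : Prop
    extends HasCMVFactorShape k G G₁ G₂ where
  rank_low₁ : ∀ p, FullRankBlock k G₁ (2 * p + 1) (2 * p)
  rank_up₁ : ∀ p, FullRankBlock k G₁ (2 * p) (2 * p + 1)
  rank_low₂ : ∀ p, FullRankBlock k G₂ (2 * p + 2) (2 * p + 1)
  rank_up₂ : ∀ p, FullRankBlock k G₂ (2 * p + 1) (2 * p + 2)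

def IsUpperHessenberg {n : ℕ} (H : Matrix (Fin n) (Fin n) ℂ) : Prop :=
  ∀ i j : Fin n, (j : ℕ) + 1 < (i : ℕ) → H i j = 0

def IsLowerHessenberg {n : ℕ} (H : Matrix (Fin n) (Fin n) ℂ) : Prop :=
  ∀ i j : Fin n, (i : ℕ) + 1 < (j : ℕ) → H i j = 0

/-- The triple `(L, F, R)` represents `A` in the LFR format. In `middle`, `Q = diag(I_k, Q̂)` with
`Q̂` unitary Hessenberg (equivalently, `Q` itself is unitary Hessenberg). -/
structure IsLFR {n : ℕ} (k : ℕ) (A L F R : Matrix (Fin n) (Fin n) ℂ) : Prop where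
  eq_mul : A = L * F * R
  left : ∃ H : Fin k → Matrix (Fin n) (Fin n) ℂ,
    (∀ t, H t ∈ unitaryGroup (Fin n) ℂ ∧ IsLowerHessenberg (H t)) ∧ L = (List.ofFn H).prod
  right : ∃ H : Fin k → Matrix (Fin n) (Fin n) ℂ,
    (∀ t, H t ∈ unitaryGroup (Fin n) ℂ ∧ IsUpperHessenberg (H t)) ∧ R = (List.ofFn H).prod
  middle : ∃ (Q : Matrix (Fin n) (Fin n) ℂ) (Z : Matrix (Fin n) (Fin k) ℂ),
    Q ∈ unitaryGroup (Fin n) ℂ ∧ IsUpperHessenberg Q ∧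
    (∀ i j : Fin n, (i : ℕ) < k ∨ (j : ℕ) < k → Q i j = (1 : Matrix (Fin n) (Fin n) ℂ) i j) ∧
    F = Q + firstCols n k * Zᴴ

/-- The block Krylov matrix `[W, D W, …, D^(m-1) W]`. -/
def blockKrylov {n k : ℕ} (D : Matrix (Fin n) (Fin n) ℂ) (W : Matrix (Fin n) (Fin k) ℂ) (m : ℕ) :
    Matrix (Fin n) (Fin m × Fin k) ℂ :=
  Matrix.of fun i p => (D ^ (p.1 : ℕ) * W) i p.2

/-- The pair `(D, U)` does not break down: the column space of `U` is contained in that of some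
`W` with `k` columns all of whose block Krylov matrices have the largest possible rank. (If `U` has
rank `k`, then `W` has the same column space as `U`, and this is a condition on `U` itself.) -/
def KrylovNondegenerate {n k : ℕ} (D : Matrix (Fin n) (Fin n) ℂ) (U : Matrix (Fin n) (Fin k) ℂ) :
    Prop :=
  ∃ (W : Matrix (Fin n) (Fin k) ℂ) (C : Matrix (Fin k) (Fin k) ℂ),
    U = W * C ∧ ∀ m : ℕ, (blockKrylov D W m).rank = min n (m * k)

/-! Everything is read on the flag of leading coordinate subspaces. Let `S_c` be `G` for odd `c` and
`Gᴴ` for even `c`. The CMV pattern says that `S_m` sends the span of the first `m` coordinate blocks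
into that of the first `m + 1`; the `R_i` and `L_i` are the blocks `(c, c - 2)` of `S_c`. Their full
rank lets any `x` in the first `c + 1` blocks be written as `t + S_c u` with `t`, `u` in the first
`c` blocks (`exists_sub_stairOp_mem`).

Reduction: orthonormalize the columns of `W, D⁻¹W, DW, D⁻²W, …`. In the new basis `S_c` carries the
Krylov block number `c - 2` to number `c`, which gives the pattern and the triangularity; maximal
Krylov rank identifies the Krylov spaces with the flag and gives full rank (`exists_isBlockCMV`).
Conversely, for `W = PᴴE` the decomposition above regenerates the flag from `W`, so the ranks are
maximal.

Factorization: with `E_j` the `j`-th block of coordinate columns, orthonormalize `G E_0, E_0, G E_1,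
E_2, G E_3, …` to get `G₁`, and set `G₂ = G₁ᴴ G` (`exists_isCMVFactorization`). A unitary matrix of
lower bandwidth `k` is a product of `k` unitary Hessenberg matrices, and `G₂ E = E`; this gives the
LFR form.

Degenerate pairs are reached by a limit. Pairs admitting a possibly singular reduction and
factorization form a closed set, being a projection along compact unitary groups. For distinct
eigenvalues a Vandermonde determinant shows that generic `U` is nondegenerate, and every unitary
diagonal `D` is a limit of ones with distinct eigenvalues. -/

/-! ### Leading coordinate subspaces -/

/-- The vectors of `ℂⁿ` all of whose coordinates from position `m` on vanish. -/
def leadingSpace (n m : ℕ) : Submodule ℂ (Fin n → ℂ) where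
  carrier := {x | ∀ i : Fin n, m ≤ (i : ℕ) → x i = 0}
  add_mem' := fun hx hy i hi => by simp [hx i hi, hy i hi]
  zero_mem' := fun _ _ => rfl
  smul_mem' := fun c x hx i hi => by simp [hx i hi]

lemma mem_leadingSpace {n m : ℕ} {x : Fin n → ℂ} :
    x ∈ leadingSpace n m ↔ ∀ i : Fin n, m ≤ (i : ℕ) → x i = 0 := Iff.rfl

lemma leadingSpace_mono (n : ℕ) : Monotone (leadingSpace n) :=
  fun _ _ h _ hx i hi => hx i (h.trans hi)

lemma leadingSpace_eq_top {n m : ℕ} (h : n ≤ m) : leadingSpace n m = ⊤ :=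
  eq_top_iff.2 fun _ _ i hi => absurd i.2 (by omega)

lemma eq_zero_of_mem_leadingSpace_zero {n : ℕ} {x : Fin n → ℂ} (h : x ∈ leadingSpace n 0) :
    x = 0 := funext fun i => h i (Nat.zero_le _)

lemma finrank_leadingSpace (n m : ℕ) : Module.finrank ℂ (leadingSpace n m) = min n m := by
  classical
  have e := LinearMap.iInfKerProjEquiv ℂ (fun _ : Fin n => ℂ) (I := {i | (i : ℕ) < m})
    (J := {i | m ≤ (i : ℕ)})
    (Set.disjoint_left.2 fun i (h : (i : ℕ) < m) (h' : m ≤ (i : ℕ)) => by omega)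
    (fun i _ => (lt_or_ge (i : ℕ) m).imp id id)
  have h : leadingSpace n m = ⨅ i ∈ {i : Fin n | m ≤ (i : ℕ)},
      LinearMap.ker (LinearMap.proj i : ((_ : Fin n) → ℂ) →ₗ[ℂ] ℂ) := by
    ext x; simp [mem_leadingSpace]
  rw [h, e.finrank_eq, Module.finrank_fintype_fun_eq_card, Fintype.card_subtype]
  simp [Fin.card_filter_val_lt]

lemma single_mem_leadingSpace {n m : ℕ} {q : Fin n} (h : (q : ℕ) < m) :
    (Pi.single q 1 : Fin n → ℂ) ∈ leadingSpace n m := fun i hi =>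
  Pi.single_eq_of_ne (fun e => by subst e; omega) _

lemma mem_of_support {n : ℕ} {S : Submodule ℂ (Fin n → ℂ)} {x : Fin n → ℂ}
    (h : ∀ q : Fin n, x q ≠ 0 → (Pi.single q 1 : Fin n → ℂ) ∈ S) : x ∈ S := by
  rw [pi_eq_sum_univ' x]
  refine S.sum_mem fun q _ => ?_
  by_cases hq : x q = 0
  · simp [hq]
  · convert S.smul_mem (x q) (h q hq) using 2

lemma leadingSpace_le {n m : ℕ} {S : Submodule ℂ (Fin n → ℂ)}
    (h : ∀ q : Fin n, (q : ℕ) < m → (Pi.single q 1 : Fin n → ℂ) ∈ S) : leadingSpace n m ≤ S :=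
  fun _ hx => mem_of_support fun q hq => h q (by by_contra h'; exact hq (hx q (by omega)))

/-- Splitting off the last `k` coordinates. -/
lemma exists_split_leadingSpace {n k m : ℕ} {x : Fin n → ℂ} (hk : 0 < k)
    (hx : x ∈ leadingSpace n ((m + 1) * k)) :
    ∃ y ∈ leadingSpace n (m * k), ∃ u : Fin n → ℂ,
      (∀ i : Fin n, (i : ℕ) / k ≠ m → u i = 0) ∧ x = y + u := by
  refine ⟨fun i => if (i : ℕ) < m * k then x i else 0, fun i hi => if_neg (by omega),
    fun i => if (i : ℕ) < m * k then 0 else x i, fun i hi => ?_, ?_⟩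
  · show (if _ then _ else _) = _
    split_ifs with h
    · rfl
    refine hx i ?_
    by_contra h'
    exact hi (le_antisymm (Nat.lt_succ_iff.1 ((Nat.div_lt_iff_lt_mul hk).2 (by simpa using h')))
      ((Nat.le_div_iff_mul_le hk).2 (by omega)))
  · ext i; simp only [Pi.add_apply]; split_ifs <;> simp

lemma mem_leadingSpace_of_block {n k m : ℕ} (hk : 0 < k) {u : Fin n → ℂ}
    (hu : ∀ i : Fin n, (i : ℕ) / k ≠ m → u i = 0) : u ∈ leadingSpace n ((m + 1) * k) := by
  intro i hi
  refine hu i (fun h => ?_)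
  have := (Nat.le_div_iff_mul_le hk).2 hi
  omega

/-! ### Unitary matrices acting on subspaces -/

lemma conjTranspose_mul_self_of_unitary {n : ℕ} {M : Matrix (Fin n) (Fin n) ℂ}
    (hM : M ∈ unitaryGroup (Fin n) ℂ) : Mᴴ * M = 1 := mem_unitaryGroup_iff'.1 hM

lemma mul_conjTranspose_self_of_unitary {n : ℕ} {M : Matrix (Fin n) (Fin n) ℂ}
    (hM : M ∈ unitaryGroup (Fin n) ℂ) : M * Mᴴ = 1 := mem_unitaryGroup_iff.1 hM

lemma conjTranspose_mem_unitary {n : ℕ} {M : Matrix (Fin n) (Fin n) ℂ}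
    (hM : M ∈ unitaryGroup (Fin n) ℂ) : Mᴴ ∈ unitaryGroup (Fin n) ℂ :=
  Unitary.star_mem hM

/-- `M` is injective on the finite-dimensional `S`, hence onto `S`, so its inverse `Mᴴ` also
preserves `S`. -/
lemma conjTranspose_mulVec_mem {n : ℕ} {M : Matrix (Fin n) (Fin n) ℂ}
    (hM : M ∈ unitaryGroup (Fin n) ℂ) {S : Submodule ℂ (Fin n → ℂ)}
    (h : ∀ x ∈ S, M *ᵥ x ∈ S) : ∀ x ∈ S, Mᴴ *ᵥ x ∈ S := by
  intro x hx
  have hMM := conjTranspose_mul_self_of_unitary hM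
  have hinj : Function.Injective ((mulVecLin M).restrict (p := S) (q := S) h) := by
    intro a b hab
    have : M *ᵥ (a : Fin n → ℂ) = M *ᵥ b := congrArg Subtype.val hab
    have := congrArg (fun z => Mᴴ *ᵥ z) this
    simpa [mulVec_mulVec, hMM] using this
  obtain ⟨y, hy⟩ := LinearMap.surjective_of_injective hinj ⟨x, hx⟩
  have hy' : M *ᵥ (y : Fin n → ℂ) = x := congrArg Subtype.val hy
  rw [← hy', mulVec_mulVec, hMM, one_mulVec]
  exact y.2

lemma mulVec_single_apply {n : ℕ} (M : Matrix (Fin n) (Fin n) ℂ) (i j : Fin n) :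
    (M *ᵥ Pi.single j 1) i = M i j := by simp

lemma conjTranspose_apply_eq_zero {n : ℕ} {M : Matrix (Fin n) (Fin n) ℂ} {i j : Fin n} :
    Mᴴ i j = 0 ↔ M j i = 0 := by simp [conjTranspose_apply]

/-! ### Gram–Schmidt adapted to a filtration -/

open Module in
-- Gram–Schmidt that survives breakdown: when `v m` depends on the earlier vectors, the dimension
-- hypothesis supplies a substitute in `W m`. The last clause, keeping vectors that are already
-- orthonormal, is what later forces the leading `I_k` of `G₂`.
lemma exists_orthonormal_adapted {E : Type*} [NormedAddCommGroup E] [InnerProductSpace ℂ E]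
    [FiniteDimensional ℂ E] (W : ℕ → Submodule ℂ E) (hW : Monotone W) (v : ℕ → E) (N : ℕ)
    (hdim : ∀ q < N, q < finrank ℂ (W q)) (hv : ∀ q < N, v q ∈ W q) :
    ∀ m ≤ N, ∃ z : ℕ → E, Orthonormal ℂ (fun i : Fin m => z i) ∧
      ∀ q < m, z q ∈ W q ∧ v q ∈ Submodule.span ℂ (z '' Set.Iic q) ∧
        (‖v q‖ = 1 → (∀ p < q, inner ℂ (z p) (v q) = 0) → z q = v q) := by
  classical
  intro m
  induction m with
  | zero => exact fun _ => ⟨fun _ => 0, ⟨fun i => i.elim0, fun i => i.elim0⟩, fun q hq => by omega⟩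
  | succ m ih =>
    intro hm
    obtain ⟨z, hz, hprop⟩ := ih (by omega)
    set S := Submodule.span ℂ (z '' Set.Iio m) with hS
    have hSW : S ≤ W m := Submodule.span_le.2 (by
      rintro _ ⟨p, hp, rfl⟩; exact hW (le_of_lt hp) (hprop p hp).1)
    have hSfin : finrank ℂ S ≤ m := by
      have := finrank_span_finset_le_card (R := ℂ) ((Finset.range m).image z)
      rw [Finset.coe_image, Finset.coe_range] at this
      exact this.trans (Finset.card_image_le.trans (by simp))
    have hex : ∃ w ∈ W m, w ∉ S ∧ (v m ∉ S → w = v m) := by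
      by_cases hvS : v m ∈ S
      · have hlt : S < W m := lt_of_le_of_ne hSW (fun h => by
          have := hdim m (by omega); rw [← h] at this; omega)
        obtain ⟨w, hw, hw'⟩ := SetLike.exists_of_lt hlt
        exact ⟨w, hw, hw', fun h => absurd hvS h⟩
      · exact ⟨v m, hv m (by omega), hvS, fun _ => rfl⟩
    obtain ⟨w, hwW, hwS, hwv⟩ := hex
    set r := w - S.starProjection w with hr
    have hrS : ∀ s ∈ S, inner ℂ s r = 0 := fun s hs =>
      (Submodule.mem_orthogonal S r).1 (Submodule.sub_starProjection_mem_orthogonal w) s hs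
    have hr0 : r ≠ 0 := fun h => hwS (by
      rw [sub_eq_zero.1 h]; exact Submodule.starProjection_apply_mem S w)
    have hrn : (‖r‖ : ℂ) ≠ 0 := by exact_mod_cast norm_ne_zero_iff.2 hr0
    set u := ((‖r‖ : ℂ)⁻¹) • r with hu
    have hun : ‖u‖ = 1 := by
      rw [hu, norm_smul, norm_inv, Complex.norm_real, norm_norm,
        inv_mul_cancel₀ (norm_ne_zero_iff.2 hr0)]
    have huS : ∀ s ∈ S, inner ℂ s u = 0 := fun s hs => by
      rw [hu, inner_smul_right, hrS s hs, mul_zero]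
    have huW : u ∈ W m := (W m).smul_mem _ ((W m).sub_mem hwW
      (hSW (Submodule.starProjection_apply_mem S w)))
    have hzlt : ∀ p, p < m → Function.update z m u p = z p := fun p hp =>
      Function.update_of_ne (by omega) _ _
    have hzm : Function.update z m u m = u := Function.update_self _ _ _
    have hzS : ∀ p < m, z p ∈ S := fun p hp => Submodule.subset_span ⟨p, hp, rfl⟩
    refine ⟨Function.update z m u, ⟨fun i => ?_, fun i j hij => ?_⟩, fun q hq => ?_⟩
    · rcases Nat.lt_succ_iff_lt_or_eq.1 i.2 with h | h
      · simpa [hzlt _ h] using hz.1 ⟨i, h⟩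
      · simpa [h] using hun
    · rcases Nat.lt_succ_iff_lt_or_eq.1 i.2 with h | h <;>
        rcases Nat.lt_succ_iff_lt_or_eq.1 j.2 with h' | h'
      · simpa [hzlt _ h, hzlt _ h'] using
          hz.2 (i := ⟨i, h⟩) (j := ⟨j, h'⟩) (fun e => hij (Fin.ext (by simpa using e)))
      · simpa [hzlt _ h, h'] using huS _ (hzS _ h)
      · have := inner_eq_zero_symm.1 (huS _ (hzS _ h'))
        simpa [hzlt _ h', h] using this
      · exact absurd (Fin.ext (h.trans h'.symm)) hij
    · rcases Nat.lt_succ_iff_lt_or_eq.1 hq with h | rfl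
      · have himg : Function.update z m u '' Set.Iic q = z '' Set.Iic q :=
          Set.image_congr fun p hp => hzlt p (lt_of_le_of_lt hp h)
        refine ⟨by rw [hzlt _ h]; exact (hprop q h).1, by rw [himg]; exact (hprop q h).2.1,
          fun h1 h2 => ?_⟩
        rw [hzlt _ h]
        exact (hprop q h).2.2 h1 fun p hp => by
          have := h2 p hp; rwa [hzlt _ (by omega)] at this
      · have hle : S ≤ Submodule.span ℂ (Function.update z q u '' Set.Iic q) :=
          Submodule.span_le.2 (by
            rintro _ ⟨p, hp, rfl⟩
            exact Submodule.subset_span ⟨p, Set.mem_Iic.2 (le_of_lt hp), hzlt p hp⟩)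
        have hum : u ∈ Submodule.span ℂ (Function.update z q u '' Set.Iic q) :=
          Submodule.subset_span ⟨q, Set.mem_Iic.2 le_rfl, hzm⟩
        refine ⟨by rw [hzm]; exact huW, ?_, fun h1 h2 => ?_⟩
        · by_cases hvS : v q ∈ S
          · exact hle hvS
          · have : v q = (‖r‖ : ℂ) • u + S.starProjection w := by
              rw [hu, smul_smul, mul_inv_cancel₀ hrn, one_smul, hr, ← hwv hvS, sub_add_cancel]
            rw [this]
            exact Submodule.add_mem _ (Submodule.smul_mem _ _ hum)
              (hle (Submodule.starProjection_apply_mem S w))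
        · rw [hzm]
          have hvo : v q ∈ Sᗮ := by
            rw [hS, Submodule.mem_orthogonal]
            intro s hs
            induction hs using Submodule.span_induction with
            | mem x hx =>
              obtain ⟨p, hp, rfl⟩ := hx
              have := h2 p hp; rwa [hzlt _ hp] at this
            | zero => simp
            | add x y _ _ hx hy => rw [inner_add_left, hx, hy, add_zero]
            | smul a x _ hx => rw [inner_smul_left, hx, mul_zero]
          have hvS : v q ∉ S := fun h => by
            have := (Submodule.mem_orthogonal S _).1 hvo _ h
            rw [inner_self_eq_zero] at this
            rw [this, norm_zero] at h1; exact zero_ne_one h1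
          have hwv' := hwv hvS
          have hr' : r = v q := by
            rw [hr, hwv', (Submodule.starProjection_apply_eq_zero_iff _).2 hvo, sub_zero]
          rw [hu, hr', h1]; simp

/-- A unitary matrix whose columns lie in a given filtration `W` and span, successively, the
vectors `v q`. A unit vector `v q` orthogonal to the previous columns is kept unchanged. -/
lemma exists_unitary_adapted {n : ℕ} (W : ℕ → Submodule ℂ (Fin n → ℂ)) (hW : Monotone W)
    (v : ℕ → Fin n → ℂ) (hdim : ∀ q < n, q < Module.finrank ℂ (W q)) (hv : ∀ q < n, v q ∈ W q) :
    ∃ H ∈ unitaryGroup (Fin n) ℂ, ∀ q : Fin n, H *ᵥ Pi.single q 1 ∈ W q ∧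
      Hᴴ *ᵥ v q ∈ leadingSpace n (q + 1) ∧
      (star (v q) ⬝ᵥ v q = 1 → (∀ p < q, star (H *ᵥ Pi.single p 1) ⬝ᵥ v q = 0) →
        H *ᵥ Pi.single q 1 = v q) := by
  let e := WithLp.linearEquiv 2 ℂ (Fin n → ℂ)
  have hin : ∀ x y : EuclideanSpace ℂ (Fin n), inner ℂ x y = star (e x) ⬝ᵥ e y := fun x y => by
    rw [EuclideanSpace.inner_eq_star_dotProduct, dotProduct_comm]; rfl
  obtain ⟨z, hz, hprop⟩ := exists_orthonormal_adapted (fun q => (W q).map e.symm.toLinearMap)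
    (fun a b h => Submodule.map_mono (hW h)) (fun q => e.symm (v q)) n
    (fun q hq => by rw [LinearEquiv.finrank_map_eq]; exact hdim q hq)
    (fun q hq => Submodule.mem_map_of_mem (hv q hq)) n le_rfl
  let H : Matrix (Fin n) (Fin n) ℂ := Matrix.of fun i j => e (z j) i
  have hcol : ∀ j : Fin n, H *ᵥ Pi.single j 1 = e (z j) := fun j => by
    ext i; rw [mulVec_single_apply]; rfl
  have hHv : ∀ (x : Fin n → ℂ) (i : Fin n), (Hᴴ *ᵥ x) i = star (e (z i)) ⬝ᵥ x := fun x i => rfl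
  refine ⟨H, ?_, fun q => ⟨?_, ?_, fun h1 h2 => ?_⟩⟩
  · rw [mem_unitaryGroup_iff', star_eq_conjTranspose]
    ext i j
    rw [← mulVec_single_apply (Hᴴ * H) i j, ← mulVec_mulVec, hcol, hHv, ← hin,
      orthonormal_iff_ite.1 hz i j, one_apply]
  · obtain ⟨x, hx, hxz⟩ := (hprop q q.2).1
    rw [hcol, ← hxz]; simpa using hx
  · intro i hi
    rw [hHv]
    have := (hprop q q.2).2.1
    have key : ∀ x ∈ Submodule.span ℂ (z '' Set.Iic (q : ℕ)), inner ℂ (z i) x = 0 := by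
      intro x hx
      induction hx using Submodule.span_induction with
      | mem x hx =>
        obtain ⟨p, hp, rfl⟩ := hx
        have hp' : p ≤ (q : ℕ) := hp
        exact hz.2 (i := i) (j := ⟨p, by omega⟩) (fun h => by
          have := congrArg Fin.val h; simp at this; omega)
      | zero => simp
      | add x y _ _ hx hy => rw [inner_add_right, hx, hy, add_zero]
      | smul a x _ hx => rw [inner_smul_right, hx, mul_zero]
    have := key _ this
    rw [hin] at this; simpa using this
  · rw [hcol]
    have h1' : ‖e.symm (v q)‖ = 1 := by
      have h3 : inner ℂ (e.symm (v q)) (e.symm (v q)) = 1 := by rw [hin]; simpa using h1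
      rw [inner_self_eq_norm_sq_to_K] at h3
      have h4 : ‖e.symm (v q)‖ ^ 2 = 1 := Complex.ofReal_injective (by simpa using h3)
      exact (pow_eq_one_iff_of_nonneg (norm_nonneg _) two_ne_zero).1 h4
    rw [(hprop q q.2).2.2 h1' (fun p hp => by
      have := h2 ⟨p, hp.trans q.2⟩ hp
      rw [hcol] at this
      rw [hin]; simpa using this)]
    simp

/-- If `v q ∈ ⟨e₀, …, e_q⟩` for all `q` and the first `M` of these vectors span
`⟨e₀, …, e_{M-1}⟩`, then so do the shorter initial segments. -/
lemma leadingSpace_le_span_of_triangular {n M : ℕ} (hM : M ≤ n) (v : ℕ → Fin n → ℂ)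
    (hv : ∀ q < M, v q ∈ leadingSpace n (q + 1))
    (hspan : leadingSpace n M ≤ Submodule.span ℂ (v '' Set.Iio M)) {q : ℕ} (hq : q ≤ M) :
    leadingSpace n q ≤ Submodule.span ℂ (v '' Set.Iio q) := by
  have hfin : ∀ p ≤ M, Submodule.span ℂ (v '' Set.Iio p) ≤ leadingSpace n p := fun p hp =>
    Submodule.span_le.2 (by
      rintro _ ⟨r, hr, rfl⟩
      have hr' : r < p := hr
      exact leadingSpace_mono n (by omega) (hv r (by omega)))
  have hrange : ∀ p, Set.range (fun i : Fin p => v i) = v '' Set.Iio p := fun p => by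
    ext x; constructor
    · rintro ⟨i, rfl⟩; exact ⟨i, i.2, rfl⟩
    · rintro ⟨i, hi, rfl⟩; exact ⟨⟨i, hi⟩, rfl⟩
  -- `M` vectors spanning an `M`-dimensional space are independent; an initial segment is then
  -- independent too, and fills its leading space by dimension.
  have hli : LinearIndependent ℂ (fun i : Fin M => v i) := by
    rw [linearIndependent_iff_card_eq_finrank_span, Set.finrank, hrange,
      le_antisymm (hfin M le_rfl) hspan, finrank_leadingSpace]
    simp [hM]
  have hli' : LinearIndependent ℂ (fun i : Fin q => v i) :=
    hli.comp (Fin.castLE hq) (Fin.castLE_injective hq)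
  rw [linearIndependent_iff_card_eq_finrank_span, Set.finrank, hrange] at hli'
  refine (Submodule.eq_of_le_of_finrank_eq (hfin q hq) ?_).ge
  rw [← hli', finrank_leadingSpace]
  simp; omega

/-! ### Blocks of full rank -/

/-- Shifting indices down by `(a - b) * k` injects group `a` into group `b`; hence for blocks on or
below the diagonal full rank means surjectivity. -/
lemma card_block_le {n k a b : ℕ} (hk : 0 < k) (hab : b ≤ a) :
    Fintype.card {i : Fin n // (i : ℕ) / k = a} ≤ Fintype.card {i : Fin n // (i : ℕ) / k = b} := by
  refine Fintype.card_le_of_injective (fun i => ⟨⟨(i : ℕ) - (a - b) * k, by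
    have := i.1.2; omega⟩, ?_⟩) ?_
  · have hi := i.2
    simp only
    rw [mul_comm, Nat.sub_mul_div, hi]; omega
  · intro i j h
    have h' : ((i : Fin n) : ℕ) - (a - b) * k = ((j : Fin n) : ℕ) - (a - b) * k :=
      congrArg (fun x : {i : Fin n // (i : ℕ) / k = b} => ((x : Fin n) : ℕ)) h
    have key : ∀ i : {i : Fin n // (i : ℕ) / k = a}, (a - b) * k ≤ ((i : Fin n) : ℕ) := fun i => by
      have := (Nat.le_div_iff_mul_le hk).1 i.2.ge
      exact (Nat.mul_le_mul_right k (Nat.sub_le a b)).trans this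
    have h1 := key i
    have h2 := key j
    exact Subtype.ext (Fin.ext (by omega))

/-- A block that is not higher than wide has full rank iff it is onto. -/
lemma fullRankBlock_iff {n k a b : ℕ} (hk : 0 < k) (hab : b ≤ a)
    (M : Matrix (Fin n) (Fin n) ℂ) :
    FullRankBlock k M a b ↔ ∀ v : Fin n → ℂ, ∃ u : Fin n → ℂ,
      (∀ i : Fin n, (i : ℕ) / k ≠ b → u i = 0) ∧
        ∀ i : Fin n, (i : ℕ) / k = a → (M *ᵥ u) i = v i := by
  have h1 : FullRankBlock k M a b ↔ Function.Surjective (kBlock k M a b).mulVecLin := by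
    rw [FullRankBlock, min_eq_left (card_block_le hk hab), ← LinearMap.range_eq_top, Matrix.rank]
    constructor
    · intro h
      exact Submodule.eq_top_of_finrank_eq (by rw [h, Module.finrank_fintype_fun_eq_card])
    · intro h; rw [h, finrank_top, Module.finrank_fintype_fun_eq_card]
  have hmul : ∀ (u : Fin n → ℂ), (∀ i : Fin n, (i : ℕ) / k ≠ b → u i = 0) →
      ∀ i : {i : Fin n // (i : ℕ) / k = a},
        (kBlock k M a b *ᵥ fun j => u j) i = (M *ᵥ u) i := by
    intro u hu i
    simp only [mulVec, dotProduct, kBlock, submatrix_apply]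
    rw [← Finset.sum_subtype (Finset.univ.filter fun j : Fin n => (j : ℕ) / k = b)
      (fun j => by simp) (fun j => M i j * u j), Finset.sum_filter]
    exact Finset.sum_congr rfl fun j _ => by
      split_ifs with h
      · rfl
      · rw [hu j h, mul_zero]
  rw [h1]
  constructor
  · intro h v
    obtain ⟨u, hu⟩ := h fun i => v i
    let u' : Fin n → ℂ := fun j => if hj : (j : ℕ) / k = b then u ⟨j, hj⟩ else 0
    have hu' : ∀ i : Fin n, (i : ℕ) / k ≠ b → u' i = 0 := fun i hi => dif_neg hi
    refine ⟨u', hu', fun i hi => ?_⟩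
    have h2 := hmul u' hu' ⟨i, hi⟩
    have h3 : (fun j : {j : Fin n // (j : ℕ) / k = b} => u' j) = u :=
      funext fun j => dif_pos j.2
    rw [h3] at h2
    rw [← h2]
    exact congrFun hu ⟨i, hi⟩
  · intro h v
    obtain ⟨u, hu, huv⟩ := h fun i => if hi : (i : ℕ) / k = a then v ⟨i, hi⟩ else 0
    refine ⟨fun j => u j, funext fun i => ?_⟩
    rw [mulVecLin_apply, hmul u hu i, huv i i.2, dif_pos i.2]

open ComplexOrder in
lemma fullRankBlock_conjTranspose {n k a b : ℕ} (M : Matrix (Fin n) (Fin n) ℂ) :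
    FullRankBlock k Mᴴ b a ↔ FullRankBlock k M a b := by
  have h : kBlock k Mᴴ b a = (kBlock k M a b)ᴴ := rfl
  rw [FullRankBlock, FullRankBlock, h, rank_conjTranspose, min_comm]

/-! ### The staircase pattern in terms of leading subspaces -/

/-- The matrix whose action produces the block `c` of the block CMV staircase: `G` for odd `c` and
`Gᴴ` for even `c`. -/
noncomputable def stairOp {n : ℕ} (G : Matrix (Fin n) (Fin n) ℂ) (c : ℕ) :
    Matrix (Fin n) (Fin n) ℂ := if c % 2 = 1 then G else Gᴴ

/-- The block CMV pattern, in a form that treats `G` and `Gᴴ` alike. The distinguished blocks are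
the blocks `(c, c - 2)` of `stairOp G c`, where `1 - 2 = 0`. -/
lemma hasBlockCMVShape_iff {n k : ℕ} {G : Matrix (Fin n) (Fin n) ℂ} :
    HasBlockCMVShape k G ↔ G ∈ unitaryGroup (Fin n) ℂ ∧
      (∀ m, 1 ≤ m → ∀ i q : Fin n, (q : ℕ) / k < m → m < (i : ℕ) / k → stairOp G m i q = 0) ∧
      (∀ c, 1 ≤ c → ∀ i q : Fin n, (q : ℕ) / k = c - 2 → (i : ℕ) / k = c →
        (q : ℕ) % k < (i : ℕ) % k → stairOp G c i q = 0) := by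
  constructor
  · intro h
    refine ⟨h.unitary, fun m hm i q hq hi => ?_, fun c hc i q hq hi hlt => ?_⟩
    · unfold stairOp
      split_ifs with hp
      · by_contra h0
        have := h.pattern i q h0; omega
      · rw [conjTranspose_apply_eq_zero]
        by_contra h0
        have := h.pattern q i h0; omega
    · unfold stairOp
      split_ifs with hp
      · refine h.upper c (c - 2) ?_ i q hlt hi hq
        rcases Nat.lt_or_ge c 2 with h2 | h2
        · left; omega
        · right; exact ⟨(c - 3) / 2, by omega, by omega⟩
      · rw [conjTranspose_apply_eq_zero]
        exact h.lower (c - 2) c ⟨(c - 2) / 2, by omega, by omega⟩ q i hlt hq hi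
  · rintro ⟨hu, h1, h2⟩
    refine ⟨hu, fun i j h0 => ⟨?_, ?_⟩, ?_, ?_⟩
    · by_contra hlt
      refine h0 ?_
      have hj0 := Nat.zero_le ((j : ℕ) / k)
      have := h1 (2 * ((i : ℕ) / k / 2) - 1) (by omega) i j (by omega) (by omega)
      rwa [stairOp, if_pos (by omega)] at this
    · by_contra hlt
      refine h0 ?_
      have := h1 (2 * ((i : ℕ) / k / 2) + 2) (by omega) j i (by omega) (by omega)
      rwa [stairOp, if_neg (by omega), conjTranspose_apply_eq_zero] at this
    · rintro a b hab i j hlt hi hj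
      have hab' : 1 ≤ a ∧ b = a - 2 ∧ a % 2 = 1 := by
        rcases hab with ⟨rfl, rfl⟩ | ⟨p, rfl, rfl⟩ <;> omega
      have := h2 a hab'.1 i j (by omega) hi hlt
      rwa [stairOp, if_pos hab'.2.2] at this
    · rintro a b ⟨p, rfl, rfl⟩ i j hlt hi hj
      have := h2 (2 * p + 2) (by omega) j i (by omega) hj hlt
      rwa [stairOp, if_neg (by omega), conjTranspose_apply_eq_zero] at this

lemma isBlockCMV_iff {n k : ℕ} {G : Matrix (Fin n) (Fin n) ℂ} :
    IsBlockCMV k G ↔ HasBlockCMVShape k G ∧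
      ∀ c, 1 ≤ c → FullRankBlock k (stairOp G c) c (c - 2) := by
  constructor
  · intro h
    refine ⟨h.toHasBlockCMVShape, fun c hc => ?_⟩
    unfold stairOp
    split_ifs with hp
    · refine h.fullRank_R c (c - 2) ?_
      rcases Nat.lt_or_ge c 2 with h2 | h2
      · left; omega
      · right; exact ⟨(c - 3) / 2, by omega, by omega⟩
    · rw [fullRankBlock_conjTranspose]
      exact h.fullRank_L (c - 2) c ⟨(c - 2) / 2, by omega, by omega⟩
  · rintro ⟨hs, h⟩
    refine ⟨hs, fun a b hab => ?_, fun a b => ?_⟩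
    · have hab' : 1 ≤ a ∧ b = a - 2 ∧ a % 2 = 1 := by
        rcases hab with ⟨rfl, rfl⟩ | ⟨p, rfl, rfl⟩ <;> omega
      have := h a hab'.1
      rwa [stairOp, if_pos hab'.2.2, ← hab'.2.1] at this
    · rintro ⟨p, rfl, rfl⟩
      have := h (2 * p + 2) (by omega)
      rwa [stairOp, if_neg (by omega), fullRankBlock_conjTranspose] at this

lemma stairOp_mulVec_mem {n k : ℕ} (hk : 0 < k) {G : Matrix (Fin n) (Fin n) ℂ}
    (h : HasBlockCMVShape k G) {m : ℕ} (hm : 1 ≤ m) {x : Fin n → ℂ}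
    (hx : x ∈ leadingSpace n (m * k)) : stairOp G m *ᵥ x ∈ leadingSpace n ((m + 1) * k) := by
  refine leadingSpace_le (S := (leadingSpace n ((m + 1) * k)).comap (mulVecLin _))
    (fun q hq i hi => ?_) hx
  rw [mulVecLin_apply, mulVec_single_apply]
  exact (hasBlockCMVShape_iff.1 h).2.1 m hm i q ((Nat.div_lt_iff_lt_mul hk).2 hq)
    ((Nat.le_div_iff_mul_le hk).2 hi)

lemma stairOp_single_mem {n k : ℕ} (hk : 0 < k) {G : Matrix (Fin n) (Fin n) ℂ}
    (h : HasBlockCMVShape k G) {c : ℕ} (hc : 1 ≤ c) {q : Fin n} (hq : (q : ℕ) / k = c - 2) :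
    stairOp G c *ᵥ Pi.single q 1 ∈ leadingSpace n (c * k + (q : ℕ) % k + 1) := by
  intro i hi
  rw [mulVec_single_apply]
  have hci : c ≤ (i : ℕ) / k := (Nat.le_div_iff_mul_le hk).2 (by omega)
  rcases hci.eq_or_lt with h' | h'
  · refine (hasBlockCMVShape_iff.1 h).2.2 c hc i q hq h'.symm ?_
    have := Nat.div_add_mod (i : ℕ) k
    rw [← h', mul_comm] at this
    omega
  · exact (hasBlockCMVShape_iff.1 h).2.1 c hc i q (by omega) h'

/-- Full rank of the block `(c, c - 2)` makes it onto, so a `u` supported on block `c - 2`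
reproduces the coordinates of `x` in block `c`; subtracting removes that block. -/
lemma exists_sub_stairOp_mem {n k : ℕ} (hk : 0 < k) {G : Matrix (Fin n) (Fin n) ℂ}
    (h : IsBlockCMV k G) {c : ℕ} (hc : 1 ≤ c) {x : Fin n → ℂ}
    (hx : x ∈ leadingSpace n ((c + 1) * k)) :
    ∃ t ∈ leadingSpace n (c * k), ∃ u : Fin n → ℂ, (∀ i : Fin n, (i : ℕ) / k ≠ c - 2 → u i = 0) ∧
      u ∈ leadingSpace n (c * k) ∧ x = t + stairOp G c *ᵥ u := by
  obtain ⟨u, hu, hux⟩ := (fullRankBlock_iff hk (Nat.sub_le c 2) _).1 ((isBlockCMV_iff.1 h).2 c hc) x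
  have hu' : u ∈ leadingSpace n (c * k) := leadingSpace_mono n
    (Nat.mul_le_mul_right k (by omega)) (mem_leadingSpace_of_block hk hu)
  refine ⟨x - stairOp G c *ᵥ u, fun i hi => ?_, u, hu, hu', by simp⟩
  rw [Pi.sub_apply]
  have hci : c ≤ (i : ℕ) / k := (Nat.le_div_iff_mul_le hk).2 hi
  rcases hci.eq_or_lt with h' | h'
  · rw [hux i h'.symm, sub_self]
  · have hi' := (Nat.le_div_iff_mul_le hk).1 (Nat.succ_le_of_lt h')
    rw [hx i hi', stairOp_mulVec_mem hk h.toHasBlockCMVShape hc hu' i hi', sub_self]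

/-! ### Unitary band matrices as products of Hessenberg matrices -/

/-- A QR-type peeling: choose a Hessenberg `H` such that `Hᴴ * B` loses one subdiagonal, and induct
on the bandwidth. -/
lemma exists_hessenberg_factors {n : ℕ} {k : ℕ} (hk : 1 ≤ k) :
    ∀ B ∈ unitaryGroup (Fin n) ℂ, (∀ i j : Fin n, (j : ℕ) + k < i → B i j = 0) →
      ∃ H : Fin k → Matrix (Fin n) (Fin n) ℂ,
        (∀ t, H t ∈ unitaryGroup (Fin n) ℂ ∧ IsUpperHessenberg (H t)) ∧
          B = (List.ofFn H).prod := by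
  induction k, hk using Nat.le_induction with
  | base => exact fun B hB h => ⟨fun _ => B, fun _ => ⟨hB, h⟩, by simp⟩
  | succ k hk ih =>
    intro B hB hband
    obtain ⟨H, hH, hprop⟩ := exists_unitary_adapted (fun q => leadingSpace n (q + 2))
      (fun a b hab => leadingSpace_mono n (by omega))
      -- Column `j` of `B` is prescribed at position `q = j + k`: bandwidth `k + 1` puts it in
      -- `leadingSpace n (q + 2)`, and `Hᴴ` moves it into `leadingSpace n (q + 1)`. For `q < k` the
      -- vector is zero and imposes nothing.
      (fun q => B *ᵥ fun i => if (i : ℕ) + k = q then 1 else 0)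
      (fun q hq => by rw [finrank_leadingSpace]; omega)
      (fun q hq i hi => by
        rw [mulVec, dotProduct]
        refine Finset.sum_eq_zero fun j _ => ?_
        split_ifs with h
        · rw [hband i j (by omega), zero_mul]
        · rw [mul_zero])
    obtain ⟨K, hK, hprod⟩ := ih (Hᴴ * B) (mul_mem (conjTranspose_mem_unitary hH) hB)
      (fun i j hij => by
        have hjk : (j : ℕ) + k < n := by omega
        have := (hprop ⟨j + k, hjk⟩).2.1 i (by simpa using hij)
        rw [mulVec_mulVec] at this
        rw [← mulVec_single_apply (Hᴴ * B) i j, ← this]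
        congr 2
        ext p
        simp [Pi.single_apply, Fin.ext_iff])
    refine ⟨Fin.cons H K, fun t => ?_, ?_⟩
    · refine Fin.cases ⟨hH, fun i j hij => ?_⟩ (fun t => hK t) t
      have := (hprop j).1 i hij
      rwa [mulVec_single_apply] at this
    · rw [List.ofFn_succ, List.prod_cons]
      simp only [Fin.cons_zero, Fin.cons_succ]
      rw [← hprod, ← mul_assoc, mul_conjTranspose_self_of_unitary hH, one_mul]

lemma exists_lower_hessenberg_factors {n k : ℕ} (hk : 1 ≤ k) {B : Matrix (Fin n) (Fin n) ℂ}
    (hB : B ∈ unitaryGroup (Fin n) ℂ) (hband : ∀ i j : Fin n, (j : ℕ) + k < i → B i j = 0) :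
    ∃ H : Fin k → Matrix (Fin n) (Fin n) ℂ,
      (∀ t, H t ∈ unitaryGroup (Fin n) ℂ ∧ IsLowerHessenberg (H t)) ∧
        Bᴴ = (List.ofFn H).prod := by
  obtain ⟨H, hH, rfl⟩ := exists_hessenberg_factors hk B hB hband
  refine ⟨fun t => (H t.rev)ᴴ, fun t => ⟨conjTranspose_mem_unitary (hH _).1, fun i j hij => ?_⟩, ?_⟩
  · rw [conjTranspose_apply_eq_zero]; exact (hH _).2 j i hij
  · rw [conjTranspose_list_prod, List.map_ofFn]
    congr 1
    refine List.ext_getElem (by simp) fun i h1 h2 => ?_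
    simp only [List.length_reverse, List.length_ofFn] at h1
    simp [List.getElem_reverse, Fin.rev, Nat.sub_sub, add_comm]

/-! ### The LFR representation -/

lemma lt_of_block_succ {n k a : ℕ} {i j : Fin n} (hi : (i : ℕ) / k = a + 1)
    (hj : (j : ℕ) / k = a) (hij : (j : ℕ) + k < i) : (j : ℕ) % k < (i : ℕ) % k := by
  have h1 := Nat.div_add_mod (i : ℕ) k
  have h2 := Nat.div_add_mod (j : ℕ) k
  rw [hi, mul_add] at h1
  rw [hj] at h2
  omega

/-- The head `I_k` gives `G₂ᴴ E = E`, so the rank-`k` term `E U₁ (PV)ᴴ` can be pulled between `G₂ᴴ`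
and `G₁ᴴ`. The triangular corner blocks bound the bandwidth by `k`, and the middle factor has `Q =
1`. -/
lemma HasCMVFactorShape.isLFR {n k : ℕ} (hk : 0 < k) {A D P G₁ G₂ : Matrix (Fin n) (Fin n) ℂ}
    {U V : Matrix (Fin n) (Fin k) ℂ} {U₁ : Matrix (Fin k) (Fin k) ℂ} (hA : A = D + U * Vᴴ)
    (h : HasCMVFactorShape k (P * Dᴴ * Pᴴ) G₁ G₂) (hU : P * U = firstCols n k * U₁) :
    IsLFR k (P * A * Pᴴ) G₂ᴴ (1 + firstCols n k * (U₁ * (P * V)ᴴ * G₁)) G₁ᴴ := by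
  have hblock : ∀ i j : Fin n, (j : ℕ) + k < i → (j : ℕ) / k + 1 ≤ (i : ℕ) / k := fun i j hij => by
    rw [← Nat.add_div_right _ hk]; exact Nat.div_le_div_right hij.le
  have hE : G₂ * firstCols n k = firstCols n k := by
    ext i j
    by_cases hj : (j : ℕ) < n
    · have hcol : (G₂ * firstCols n k) i j = G₂ i ⟨j, hj⟩ := by
        rw [mul_apply, Finset.sum_eq_single ⟨j, hj⟩]
        · simp [firstCols]
        · intro b _ hb
          have : (b : ℕ) ≠ j := fun h => hb (Fin.ext h)
          simp [firstCols, this]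
        · simp
      rw [hcol]
      by_cases hi : (i : ℕ) < k
      · rw [h.head₂ i ⟨j, hj⟩ hi j.2]
        simp [firstCols, one_apply, Fin.ext_iff]
      · have h0 : G₂ i ⟨j, hj⟩ = 0 := by
          by_contra hne
          have := h.diag₂ _ _ hne
          have h1 : 1 ≤ (i : ℕ) / k := (Nat.le_div_iff_mul_le hk).2 (by omega)
          have h2 : (j : ℕ) / k = 0 := Nat.div_eq_of_lt j.2
          simp only [h2] at this
          omega
        have : (i : ℕ) ≠ j := by have := j.2; omega
        rw [h0]; simp [firstCols, this]
    · have h1 : ∀ i : Fin n, (i : ℕ) ≠ j := fun i => by have := i.2; omega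
      simp [mul_apply, firstCols, h1]
  have hE' : G₂ᴴ * firstCols n k = firstCols n k := by
    conv_lhs => rw [← hE]
    rw [← Matrix.mul_assoc, conjTranspose_mul_self_of_unitary h.unitary₂, Matrix.one_mul]
  refine ⟨?_, ?_, ?_, 1, (U₁ * (P * V)ᴴ * G₁)ᴴ, one_mem _, ?_, fun _ _ _ => rfl, ?_⟩
  · have h1 : P * D * Pᴴ = G₂ᴴ * G₁ᴴ := by
      rw [← conjTranspose_mul, ← h.eq_mul]
      simp [conjTranspose_mul, Matrix.mul_assoc]
    have h2 : P * (U * Vᴴ) * Pᴴ = firstCols n k * (U₁ * (P * V)ᴴ) := by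
      rw [conjTranspose_mul, ← Matrix.mul_assoc (firstCols n k), ← hU]
      simp only [Matrix.mul_assoc]
    rw [hA, Matrix.mul_add, Matrix.add_mul, h1, h2, Matrix.mul_add, Matrix.add_mul, Matrix.mul_one,
      ← Matrix.mul_assoc G₂ᴴ, hE', Matrix.mul_assoc (firstCols n k), Matrix.mul_assoc _ G₁,
      mul_conjTranspose_self_of_unitary h.unitary₁, Matrix.mul_one]
  · refine exists_lower_hessenberg_factors hk h.unitary₂ fun i j hij => ?_
    by_contra hne
    have h1 := h.diag₂ i j hne
    have h2 := hblock i j hij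
    have h3 : (i : ℕ) / k = (j : ℕ) / k + 1 := by omega
    exact hne (h.upper₂ (((j : ℕ) / k) / 2) i j (lt_of_block_succ h3 rfl hij) (by omega) (by omega))
  · refine exists_hessenberg_factors hk _ (conjTranspose_mem_unitary h.unitary₁) fun i j hij => ?_
    rw [conjTranspose_apply_eq_zero]
    by_contra hne
    have h1 := h.diag₁ j i hne
    have h2 := hblock i j hij
    have h3 : (i : ℕ) / k = (j : ℕ) / k + 1 := by omega
    exact hne (h.lower₁ (((j : ℕ) / k) / 2) j i (lt_of_block_succ h3 rfl hij) (by omega) (by omega))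
  · intro i j hij
    exact one_apply_ne (fun h => by subst h; omega)
  · rw [conjTranspose_conjTranspose]

/-! ### The CMV factorization of a block CMV matrix -/

/-- `G` for odd `m`, and the identity for even `m`. -/
noncomputable def alternating {n : ℕ} (G : Matrix (Fin n) (Fin n) ℂ) (m : ℕ) :
    Matrix (Fin n) (Fin n) ℂ := if m % 2 = 1 then G else 1

lemma alternating_add_two {n : ℕ} (G : Matrix (Fin n) (Fin n) ℂ) (m : ℕ) :
    alternating G (m + 2) = alternating G m := by
  unfold alternating; rw [Nat.add_mod_right]

lemma alternating_mem_unitary {n : ℕ} {G : Matrix (Fin n) (Fin n) ℂ}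
    (hG : G ∈ unitaryGroup (Fin n) ℂ) (m : ℕ) : alternating G m ∈ unitaryGroup (Fin n) ℂ := by
  unfold alternating; split_ifs
  · exact hG
  · exact one_mem _

lemma alternating_succ_mul_stairOp {n : ℕ} {G : Matrix (Fin n) (Fin n) ℂ}
    (hG : G ∈ unitaryGroup (Fin n) ℂ) (m : ℕ) :
    alternating G (m + 1) * stairOp G m = alternating G m := by
  unfold alternating stairOp
  rcases Nat.mod_two_eq_zero_or_one m with h | h
  · rw [if_pos (by omega), if_neg (by omega), if_neg (by omega),
      mul_conjTranspose_self_of_unitary hG]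
  · rw [if_neg (by omega), if_pos h, if_pos h, one_mul]

lemma alternating_conjTranspose_mul {n : ℕ} {G : Matrix (Fin n) (Fin n) ℂ}
    (hG : G ∈ unitaryGroup (Fin n) ℂ) (m : ℕ) :
    (alternating G (m + 1))ᴴ * alternating G m = stairOp G m := by
  rw [← alternating_succ_mul_stairOp hG m, ← Matrix.mul_assoc,
    conjTranspose_mul_self_of_unitary (alternating_mem_unitary hG _), Matrix.one_mul]

/-- The vectors whose orthonormalization gives the columns of the first CMV factor. -/
noncomputable def factorVec {n : ℕ} (k : ℕ) (G : Matrix (Fin n) (Fin n) ℂ) (q : ℕ) : Fin n → ℂ :=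
  alternating G (q / k + 1) *ᵥ fun i => if (i : ℕ) = (if q < k then q else q - k) then 1 else 0

lemma ite_eq_single {n : ℕ} (q : Fin n) :
    (fun i : Fin n => if (i : ℕ) = (q : ℕ) then (1 : ℂ) else 0) = Pi.single q 1 := by
  ext i; simp [Pi.single_apply, Fin.ext_iff]

lemma factorVec_of_lt {n k : ℕ} (G : Matrix (Fin n) (Fin n) ℂ) {q : Fin n} (hq : (q : ℕ) < k) :
    factorVec k G q = G *ᵥ Pi.single q 1 := by
  rw [factorVec, if_pos hq, Nat.div_eq_of_lt hq, alternating, if_pos rfl, ite_eq_single]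

lemma factorVec_add {n k : ℕ} (hk : 0 < k) (G : Matrix (Fin n) (Fin n) ℂ) (q : Fin n) :
    factorVec k G ((q : ℕ) + k) = alternating G ((q : ℕ) / k) *ᵥ Pi.single q 1 := by
  rw [factorVec, if_neg (by omega), Nat.add_div_right _ hk, Nat.add_sub_cancel, ite_eq_single,
    add_assoc, alternating_add_two]

/-- Split `x` as `y + w + S_{m+1} u`, with `y` in the first `m` blocks and `w` in block `m`. Stage
`m` covers `y`, the new vectors of `factorVec` cover `w`, and `alternating_succ_mul_stairOp` reduces
the last term to stage `m + 1`. -/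
lemma alternating_mulVec_mem_span {n k : ℕ} (hk : 0 < k) {G : Matrix (Fin n) (Fin n) ℂ}
    (h : IsBlockCMV k G) (m : ℕ) : ∀ x ∈ leadingSpace n (m * k),
      alternating G m *ᵥ x ∈ Submodule.span ℂ (factorVec k G '' Set.Iio (m * k)) := by
  induction m using Nat.strong_induction_on with
  | _ m ih =>
    intro x hx
    rcases m with _ | _ | m
    · rw [zero_mul] at hx
      rw [eq_zero_of_mem_leadingSpace_zero hx, mulVec_zero]; exact zero_mem _
    · refine leadingSpace_le (S := Submodule.comap (mulVecLin (alternating G (0 + 1)))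
        (Submodule.span ℂ (factorVec k G '' Set.Iio ((0 + 1) * k)))) (fun q hq => ?_) hx
      refine Submodule.subset_span ⟨q, hq, ?_⟩
      rw [factorVec_of_lt G (by simpa using hq)]; rfl
    · obtain ⟨t, ht, u, -, hu, rfl⟩ := exists_sub_stairOp_mem hk h (c := m + 1) (by omega) hx
      obtain ⟨y, hy, w, hw, rfl⟩ := exists_split_leadingSpace hk ht
      have hmono : ∀ a ≤ m + 2, Submodule.span ℂ (factorVec k G '' Set.Iio (a * k)) ≤
          Submodule.span ℂ (factorVec k G '' Set.Iio ((m + 2) * k)) := fun a ha =>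
        Submodule.span_mono (Set.image_mono (Set.Iio_subset_Iio (Nat.mul_le_mul_right k ha)))
      rw [mulVec_add, mulVec_add, mulVec_mulVec, alternating_succ_mul_stairOp h.unitary]
      refine add_mem (add_mem ?_ ?_) (hmono (m + 1) (by omega) (ih (m + 1) (by omega) u hu))
      · rw [alternating_add_two]
        exact hmono m (by omega) (ih m (by omega) y hy)
      · refine mem_of_support (S := Submodule.comap (mulVecLin (alternating G (m + 2)))
          (Submodule.span ℂ (factorVec k G '' Set.Iio ((m + 2) * k)))) (x := w) fun q hq => ?_
        have hqm : (q : ℕ) / k = m := by by_contra hne; exact hq (hw q hne)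
        refine Submodule.subset_span ⟨q + k, ?_, ?_⟩
        · have := (Nat.div_lt_iff_lt_mul hk).1 (Nat.lt_succ_of_le hqm.le)
          simp only [Nat.succ_eq_add_one, Set.mem_Iio, add_mul] at this ⊢
          omega
        · rw [factorVec_add hk, hqm, alternating_add_two]; rfl

lemma star_mulVec_dotProduct_mulVec {n : ℕ} {M : Matrix (Fin n) (Fin n) ℂ}
    (hM : M ∈ unitaryGroup (Fin n) ℂ) (x y : Fin n → ℂ) :
    star (M *ᵥ x) ⬝ᵥ (M *ᵥ y) = star x ⬝ᵥ y := by
  rw [star_mulVec, ← dotProduct_mulVec, mulVec_mulVec, conjTranspose_mul_self_of_unitary hM,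
    one_mulVec]

lemma apply_eq_zero_of_preserves {n s : ℕ} {M : Matrix (Fin n) (Fin n) ℂ}
    (h1 : ∀ x ∈ leadingSpace n s, M *ᵥ x ∈ leadingSpace n s)
    (h2 : ∀ x ∈ leadingSpace n s, Mᴴ *ᵥ x ∈ leadingSpace n s) {i j : Fin n} (h0 : M i j ≠ 0) :
    (i : ℕ) < s ↔ (j : ℕ) < s := by
  constructor
  · intro hi
    by_contra hj
    have := h2 _ (single_mem_leadingSpace hi) j (by omega)
    rw [mulVec_single_apply, conjTranspose_apply_eq_zero] at this
    exact h0 this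
  · intro hj
    by_contra hi
    have := h1 _ (single_mem_leadingSpace hj) i (by omega)
    rw [mulVec_single_apply] at this
    exact h0 this

lemma upperTriBlock_succ {n k b : ℕ} (hk : 0 < k) {M : Matrix (Fin n) (Fin n) ℂ}
    (h : ∀ j : Fin n, (j : ℕ) / k = b → (b + 1) * k ≤ n →
      M *ᵥ Pi.single j 1 ∈ leadingSpace n ((j : ℕ) + k + 1)) :
    UpperTriBlock k M (b + 1) b := by
  intro i j hlt hi hj
  have hin := (Nat.le_div_iff_mul_le hk).1 hi.ge
  have := h j hj (by have := i.2; omega) i (by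
    have h1 := Nat.div_add_mod (i : ℕ) k
    have h2 := Nat.div_add_mod (j : ℕ) k
    rw [hi, mul_add] at h1
    rw [hj] at h2
    omega)
  rwa [mulVec_single_apply] at this

lemma upperTriBlock_conjTranspose {n k a b : ℕ} {M : Matrix (Fin n) (Fin n) ℂ} :
    UpperTriBlock k Mᴴ a b ↔ LowerTriBlock k M b a :=
  ⟨fun h i j hlt hi hj => conjTranspose_apply_eq_zero.1 (h j i hlt hj hi),
    fun h i j hlt hi hj => conjTranspose_apply_eq_zero.2 (h j i hlt hj hi)⟩

/-- Full rank of a block `(b + 1, b)` from surjectivity modulo lower blocks. -/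
lemma fullRankBlock_succ {n k b : ℕ} (hk : 0 < k) {M : Matrix (Fin n) (Fin n) ℂ}
    (h : ∀ v ∈ leadingSpace n ((b + 2) * k), ∃ u : Fin n → ℂ,
      (∀ i : Fin n, (i : ℕ) / k ≠ b → u i = 0) ∧ v - M *ᵥ u ∈ leadingSpace n ((b + 1) * k)) :
    FullRankBlock k M (b + 1) b := by
  refine (fullRankBlock_iff hk (Nat.le_succ b) M).2 fun v => ?_
  obtain ⟨u, hu, hv⟩ := h (fun i => if (i : ℕ) / k = b + 1 then v i else 0)
    (mem_leadingSpace_of_block hk fun i hi => if_neg hi)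
  refine ⟨u, hu, fun i hi => ?_⟩
  have := hv i ((Nat.le_div_iff_mul_le hk).1 hi.ge)
  simp only [Pi.sub_apply, if_pos hi] at this
  exact (sub_eq_zero.1 this).symm

/-- Treat both factors at once through `Q m`, which is `G₁ᴴ` for even `m` and `G₂ = G₁ᴴ G` for odd
`m`. That `Q m` and its adjoint preserve the first `m` blocks is exactly the block diagonality of
`G₁` (even cuts) and `G₂` (odd cuts). -/
theorem exists_isCMVFactorization {n k : ℕ} (hk : 0 < k) {G : Matrix (Fin n) (Fin n) ℂ}
    (h : IsBlockCMV k G) : ∃ G₁ G₂ : Matrix (Fin n) (Fin n) ℂ, IsCMVFactorization k G G₁ G₂ := by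
  have hG := h.unitary
  obtain ⟨G₁, hG₁, hprop⟩ := exists_unitary_adapted (n := n) (fun _ => ⊤) (fun _ _ _ => le_rfl)
    (factorVec k G) (fun q hq => by simpa using hq) (fun _ _ => trivial)
  have hv : ∀ q, G₁ᴴ *ᵥ factorVec k G q ∈ leadingSpace n (q + 1) := fun q => by
    rcases Nat.lt_or_ge q n with hq | hq
    · exact (hprop ⟨q, hq⟩).2.1
    · rw [leadingSpace_eq_top (by omega)]; trivial
  obtain ⟨Q, hQm⟩ : ∃ Q : ℕ → Matrix (Fin n) (Fin n) ℂ, ∀ m, Q m = G₁ᴴ * alternating G m :=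
    ⟨_, fun _ => rfl⟩
  have hQu : ∀ m, Q m ∈ unitaryGroup (Fin n) ℂ := fun m => by
    rw [hQm]; exact mul_mem (conjTranspose_mem_unitary hG₁) (alternating_mem_unitary hG m)
  have hQ2 : ∀ m, Q (m + 2) = Q m := fun m => by simp only [hQm, alternating_add_two]
  have hQs : ∀ m, Q (m + 1) * stairOp G m = Q m := fun m => by
    simp only [hQm, Matrix.mul_assoc, alternating_succ_mul_stairOp hG]
  have hpres : ∀ m, ∀ x ∈ leadingSpace n (m * k), Q m *ᵥ x ∈ leadingSpace n (m * k) := by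
    intro m x hx
    rw [hQm, ← mulVec_mulVec]
    have hle : Submodule.span ℂ (factorVec k G '' Set.Iio (m * k)) ≤
        (leadingSpace n (m * k)).comap (mulVecLin G₁ᴴ) := Submodule.span_le.2 (by
      rintro _ ⟨p, hp, rfl⟩
      have hp' : p < m * k := hp
      exact leadingSpace_mono n (by omega) (hv p))
    exact hle (alternating_mulVec_mem_span hk h m x hx)
  have hpres' : ∀ m, ∀ x ∈ leadingSpace n (m * k), (Q m)ᴴ *ᵥ x ∈ leadingSpace n (m * k) :=
    fun m => conjTranspose_mulVec_mem (hQu m) (hpres m)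
  have hspan : ∀ m, m * k ≤ n → ∀ q ≤ m * k, leadingSpace n q ≤
      Submodule.span ℂ ((fun q => G₁ᴴ *ᵥ factorVec k G q) '' Set.Iio q) := by
    intro m hm q hq
    refine leadingSpace_le_span_of_triangular hm _ (fun p _ => hv p) (fun x hx => ?_) hq
    have h1 := Submodule.mem_map_of_mem (f := mulVecLin G₁ᴴ)
      (alternating_mulVec_mem_span hk h m _ (hpres' m x hx))
    rw [Submodule.map_span, ← Set.image_comp] at h1
    have h2 : mulVecLin G₁ᴴ (alternating G m *ᵥ (Q m)ᴴ *ᵥ x) = x := by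
      rw [mulVecLin_apply, mulVec_mulVec, mulVec_mulVec, ← hQm,
        mul_conjTranspose_self_of_unitary (hQu m), one_mulVec]
    rw [h2] at h1
    exact h1
  -- In block `b`, column `j` of `Q b` is `G₁ᴴ` applied to the vector number `j + k`, so
  -- Gram–Schmidt places it in `leadingSpace n (j + k + 1)`.
  have hlow : ∀ b, UpperTriBlock k (Q (b + 2)) (b + 1) b := fun b =>
    upperTriBlock_succ hk fun j hj _ => by
      have := hv ((j : ℕ) + k)
      rw [factorVec_add hk, hj, mulVec_mulVec] at this
      rwa [hQ2, hQm]
  -- Expand `e_j` in the triangular vectors number `0, …, j`. Those before block `b` stay in the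
  -- first `b` blocks; those in block `b` become columns of `S_{b+1}` from block `b - 1` (block `0`
  -- if `b = 0`), where the triangularity of `R_i`, `L_i` applies.
  have hlow' : ∀ b, UpperTriBlock k (Q (b + 2))ᴴ (b + 1) b := fun b =>
    upperTriBlock_succ hk fun j hj hbn => by
      have hbj := (Nat.le_div_iff_mul_le hk).1 hj.ge
      have hjb := (Nat.div_lt_iff_lt_mul hk).1 (Nat.lt_succ_of_le hj.le)
      rw [Nat.succ_eq_add_one] at hjb
      have hmem := hspan (b + 1) hbn (j + 1) (by omega)
        (single_mem_leadingSpace (Nat.lt_succ_self _))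
      suffices hle : Submodule.span ℂ
          ((fun q => G₁ᴴ *ᵥ factorVec k G q) '' Set.Iio ((j : ℕ) + 1)) ≤
          (leadingSpace n ((j : ℕ) + k + 1)).comap (mulVecLin (Q (b + 2))ᴴ) from hle hmem
      refine Submodule.span_le.2 ?_
      rintro _ ⟨p, hp, rfl⟩
      have hp' : p < j + 1 := hp
      show (Q (b + 2))ᴴ *ᵥ (G₁ᴴ *ᵥ factorVec k G p) ∈ leadingSpace n (j + k + 1)
      rcases Nat.lt_or_ge p (b * k) with hpb | hpb
      · rw [hQ2]
        exact leadingSpace_mono n (by omega) (hpres' b _ (leadingSpace_mono n (by omega) (hv p)))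
      · have hpk : p / k = b := Nat.div_eq_of_lt_le hpb (by omega)
        have hp2 : (if p < k then p else p - k) < n := by split_ifs <;> omega
        have hmod : (if p < k then p else p - k) % k = p % k := by
          split_ifs with hlt
          · rfl
          · exact (Nat.mod_eq_sub_mod (by omega)).symm
        have hdiv : (if p < k then p else p - k) / k = b + 1 - 2 := by
          split_ifs with hlt
          · rw [hpk]; rw [Nat.div_eq_of_lt hlt] at hpk; omega
          · rw [Nat.div_eq_sub_div hk (Nat.le_of_not_lt hlt)] at hpk; rw [← hpk]; rfl
        have h3 : (Q (b + 2))ᴴ *ᵥ (G₁ᴴ *ᵥ factorVec k G p) =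
            stairOp G (b + 1) *ᵥ Pi.single ⟨_, hp2⟩ 1 := by
          rw [factorVec, hpk, ← ite_eq_single, mulVec_mulVec, mulVec_mulVec, hQm,
            conjTranspose_mul, conjTranspose_conjTranspose, Matrix.mul_assoc, Matrix.mul_assoc, ← Matrix.mul_assoc G₁,
            mul_conjTranspose_self_of_unitary hG₁, Matrix.one_mul,
            alternating_conjTranspose_mul hG]
        rw [h3]
        refine leadingSpace_mono n ?_
          (stairOp_single_mem hk h.toHasBlockCMVShape (Nat.le_add_left 1 b) hdiv)
        rw [hmod]
        have := Nat.div_add_mod p k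
        rw [hpk, mul_comm] at this
        simp only [add_mul, one_mul]
        omega
  -- Decompose `(Q (b + 2))ᴴ v` as `y + u + S_{b+1} w`. Applying `Q (b + 2)` leaves only the `u`
  -- term outside the first `b + 1` blocks.
  have hrank : ∀ b, FullRankBlock k (Q (b + 2)) (b + 1) b := fun b =>
    fullRankBlock_succ hk fun v hv => by
      obtain ⟨t, ht, w, -, hw, hx⟩ := exists_sub_stairOp_mem hk h (c := b + 1) (by omega)
        (hpres' (b + 2) v hv)
      obtain ⟨y, hy, u, hu, rfl⟩ := exists_split_leadingSpace hk ht
      refine ⟨u, hu, ?_⟩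
      have hv' : v = Q (b + 2) *ᵥ ((Q (b + 2))ᴴ *ᵥ v) := by
        rw [mulVec_mulVec, mul_conjTranspose_self_of_unitary (hQu _), one_mulVec]
      rw [hx, mulVec_add, mulVec_add, mulVec_mulVec, hQs] at hv'
      have h4 : v - Q (b + 2) *ᵥ u = Q b *ᵥ y + Q (b + 1) *ᵥ w := by
        conv_lhs => rw [hv', hQ2]
        abel
      rw [h4]
      exact add_mem (leadingSpace_mono n (Nat.mul_le_mul_right k (Nat.le_succ b)) (hpres b y hy))
        (hpres (b + 1) w hw)
  have hrank' : ∀ b, FullRankBlock k (Q (b + 2))ᴴ (b + 1) b := fun b =>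
    fullRankBlock_succ hk fun v hv => by
      obtain ⟨t, ht, w, -, hw, rfl⟩ := exists_sub_stairOp_mem hk h (c := b + 1) (by omega) hv
      obtain ⟨y, hy, u, hu, hyu⟩ := exists_split_leadingSpace hk (hpres (b + 1) w hw)
      refine ⟨u, hu, ?_⟩
      have h3 : stairOp G (b + 1) *ᵥ w = (Q (b + 2))ᴴ *ᵥ (Q (b + 1) *ᵥ w) := by
        rw [← hQs (b + 1), mulVec_mulVec, ← Matrix.mul_assoc,
          conjTranspose_mul_self_of_unitary (hQu _), Matrix.one_mul]
      have h4 : t + stairOp G (b + 1) *ᵥ w - (Q (b + 2))ᴴ *ᵥ u = t + (Q b)ᴴ *ᵥ y := by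
        rw [h3, hyu, mulVec_add, hQ2]; abel
      rw [h4]
      exact add_mem ht
        (leadingSpace_mono n (Nat.mul_le_mul_right k (Nat.le_succ b)) (hpres' b y hy))
  have hQe : ∀ p, Q (2 * p + 2) = G₁ᴴ := fun p => by
    simp only [hQm, alternating, if_neg (show ¬ (2 * p + 2) % 2 = 1 by omega), Matrix.mul_one]
  have hQo : ∀ p, Q (2 * p + 1) = G₁ᴴ * G := fun p => by
    simp only [hQm, alternating, if_pos (show (2 * p + 1) % 2 = 1 by omega)]
  have hQo' : ∀ p, Q (2 * p + 1 + 2) = G₁ᴴ * G := fun p => by rw [hQ2, hQo]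
  -- The first `k` vectors are columns of the unitary `G`, already orthonormal, so Gram–Schmidt
  -- keeps them.
  have hhead : ∀ q : ℕ, ∀ hq : q < n, q < k →
      G₁ *ᵥ Pi.single ⟨q, hq⟩ 1 = G *ᵥ Pi.single ⟨q, hq⟩ 1 := by
    intro q
    induction q using Nat.strong_induction_on with
    | _ q ih =>
      intro hq hqk
      have hf := factorVec_of_lt (k := k) G (q := ⟨q, hq⟩) hqk
      rw [← hf]
      refine (hprop ⟨q, hq⟩).2.2 ?_ fun p hp => ?_
      · rw [hf, star_mulVec_dotProduct_mulVec hG]; simp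
      · have hp' : (p : ℕ) < q := hp
        rw [hf, ih p hp' p.2 (by omega), star_mulVec_dotProduct_mulVec hG]
        simp [hp.ne']
  refine ⟨G₁, G₁ᴴ * G, ⟨?_, hG₁, mul_mem (conjTranspose_mem_unitary hG₁) hG, ?_, ?_, ?_, ?_, ?_,
    ?_, ?_⟩, ?_, ?_, ?_, ?_⟩
  · rw [← Matrix.mul_assoc, mul_conjTranspose_self_of_unitary hG₁, Matrix.one_mul]
  · intro i j h0
    have key : ∀ p, ((i : ℕ) / k < 2 * p + 2 ↔ (j : ℕ) / k < 2 * p + 2) := fun p => by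
      rw [Nat.div_lt_iff_lt_mul hk, Nat.div_lt_iff_lt_mul hk]
      refine apply_eq_zero_of_preserves (M := G₁) (fun x hx => ?_) (fun x hx => ?_) h0
      · have := hpres' _ x hx; rwa [hQe, conjTranspose_conjTranspose] at this
      · have := hpres _ x hx; rwa [hQe] at this
    have h1 := key ((i : ℕ) / k / 2)
    have h2 := key ((j : ℕ) / k / 2)
    omega
  · intro i j h0
    have key : ∀ p, ((i : ℕ) / k < 2 * p + 1 ↔ (j : ℕ) / k < 2 * p + 1) := fun p => by
      rw [Nat.div_lt_iff_lt_mul hk, Nat.div_lt_iff_lt_mul hk]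
      refine apply_eq_zero_of_preserves (fun x hx => ?_) (fun x hx => ?_) h0
      · have := hpres _ x hx; rwa [hQo] at this
      · have := hpres' _ x hx; rwa [hQo] at this
    have h1 := key (((i : ℕ) / k + 1) / 2)
    have h2 := key (((j : ℕ) / k + 1) / 2)
    omega
  · intro i j _ hj
    rw [← mulVec_single_apply (G₁ᴴ * G) i j, ← mulVec_mulVec, ← hhead j j.2 hj, mulVec_mulVec,
      conjTranspose_mul_self_of_unitary hG₁, mulVec_single_apply]
  · intro p
    have := hlow' (2 * p)
    rwa [hQe, conjTranspose_conjTranspose] at this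
  · intro p
    have := hlow (2 * p)
    rwa [hQe, upperTriBlock_conjTranspose] at this
  · intro p
    have := hlow (2 * p + 1)
    rwa [hQo'] at this
  · intro p
    have := hlow' (2 * p + 1)
    rwa [hQo', upperTriBlock_conjTranspose] at this
  · intro p
    have := hrank' (2 * p)
    rwa [hQe, conjTranspose_conjTranspose] at this
  · intro p
    have := hrank (2 * p)
    rwa [hQe, fullRankBlock_conjTranspose] at this
  · intro p
    have := hrank (2 * p + 1)
    rwa [hQo'] at this
  · intro p
    have := hrank' (2 * p + 1)
    rwa [hQo', fullRankBlock_conjTranspose] at this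

/-! ### Krylov spaces and reduction to block CMV form -/

section Krylov

variable {n k : ℕ} (P D : unitaryGroup (Fin n) ℂ) (W : Matrix (Fin n) (Fin k) ℂ)

/-- The block `P D^z W` for an integer exponent. -/
def laurentBlock (z : ℤ) : Matrix (Fin n) (Fin k) ℂ :=
  (P : Matrix (Fin n) (Fin n) ℂ) * (((D ^ z : unitaryGroup (Fin n) ℂ) : Matrix (Fin n) (Fin n) ℂ) * W)

/-- The span of the blocks `P D^z W` over the first `m` exponents of the sequence
`0, -1, 1, -2, 2, …`. -/
def laurentSpace (m : ℕ) : Submodule ℂ (Fin n → ℂ) :=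
  Submodule.span ℂ {x | ∃ z : ℤ, -((m / 2 : ℕ) : ℤ) ≤ z ∧ z < m - ((m / 2 : ℕ) : ℤ) ∧
    ∃ i, x = (laurentBlock P D W z).col i}

/-- The sequence of exponents `0, -1, 1, -2, 2, …`. -/
def stairExp (c : ℕ) : ℤ := if c % 2 = 1 then -(((c + 1) / 2 : ℕ) : ℤ) else ((c / 2 : ℕ) : ℤ)

lemma conj_mul_laurentBlock (z : ℤ) :
    ((P : Matrix (Fin n) (Fin n) ℂ) * (D : Matrix (Fin n) (Fin n) ℂ)ᴴ *
      (P : Matrix (Fin n) (Fin n) ℂ)ᴴ) * laurentBlock P D W z = laurentBlock P D W (z - 1) := by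
  have hD : (D : Matrix (Fin n) (Fin n) ℂ)ᴴ * ((D ^ z : unitaryGroup (Fin n) ℂ) :
      Matrix (Fin n) (Fin n) ℂ) = ((D ^ (z - 1) : unitaryGroup (Fin n) ℂ) : _) := by
    rw [sub_eq_neg_add, _root_.zpow_add, _root_.zpow_neg_one]; rfl
  rw [laurentBlock, laurentBlock, ← hD]
  simp only [Matrix.mul_assoc]
  rw [← Matrix.mul_assoc (P : Matrix (Fin n) (Fin n) ℂ)ᴴ,
    conjTranspose_mul_self_of_unitary P.2, Matrix.one_mul]

lemma conj_conjTranspose_mul_laurentBlock (z : ℤ) :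
    ((P : Matrix (Fin n) (Fin n) ℂ) * (D : Matrix (Fin n) (Fin n) ℂ)ᴴ *
      (P : Matrix (Fin n) (Fin n) ℂ)ᴴ)ᴴ * laurentBlock P D W z = laurentBlock P D W (z + 1) := by
  have hG : ((P : Matrix (Fin n) (Fin n) ℂ) * (D : Matrix (Fin n) (Fin n) ℂ)ᴴ *
      (P : Matrix (Fin n) (Fin n) ℂ)ᴴ) ∈ unitaryGroup (Fin n) ℂ :=
    mul_mem (mul_mem P.2 (conjTranspose_mem_unitary D.2)) (conjTranspose_mem_unitary P.2)
  have := conj_mul_laurentBlock P D W (z + 1)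
  rw [add_sub_cancel_right] at this
  rw [← this, ← Matrix.mul_assoc, conjTranspose_mul_self_of_unitary hG, Matrix.one_mul]

lemma stairOp_mul_laurentBlock (c : ℕ) (z : ℤ) :
    stairOp ((P : Matrix (Fin n) (Fin n) ℂ) * (D : Matrix (Fin n) (Fin n) ℂ)ᴴ *
      (P : Matrix (Fin n) (Fin n) ℂ)ᴴ) c * laurentBlock P D W z =
    laurentBlock P D W (if c % 2 = 1 then z - 1 else z + 1) := by
  unfold stairOp
  split_ifs
  · exact conj_mul_laurentBlock P D W z
  · exact conj_conjTranspose_mul_laurentBlock P D W z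

lemma mulVec_col {m : Type*} [Fintype m] (A : Matrix m (Fin n) ℂ) (B : Matrix (Fin n) (Fin k) ℂ)
    (i : Fin k) : A *ᵥ B.col i = (A * B).col i := by
  ext j; rfl

lemma laurentSpace_mono : Monotone (laurentSpace P D W) := by
  intro a b hab
  refine Submodule.span_mono ?_
  rintro x ⟨z, h1, h2, i, rfl⟩
  exact ⟨z, by omega, by omega, i, rfl⟩

/-- `G` lowers exponents and `Gᴴ` raises them; the exponent window grows on the left after odd `m`
and on the right after even `m`, matching the parity in `stairOp`. -/
lemma stairOp_mulVec_mem_laurentSpace {m : ℕ} {x : Fin n → ℂ}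
    (hx : x ∈ laurentSpace P D W m) :
    stairOp ((P : Matrix (Fin n) (Fin n) ℂ) * (D : Matrix (Fin n) (Fin n) ℂ)ᴴ *
      (P : Matrix (Fin n) (Fin n) ℂ)ᴴ) m *ᵥ x ∈ laurentSpace P D W (m + 1) := by
  suffices h : laurentSpace P D W m ≤ (laurentSpace P D W (m + 1)).comap (mulVecLin (stairOp _ m))
    from h hx
  refine Submodule.span_le.2 ?_
  rintro x ⟨z, h1, h2, i, rfl⟩
  refine Submodule.subset_span ⟨if m % 2 = 1 then z - 1 else z + 1, ?_, ?_, i, ?_⟩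
  · split_ifs <;> omega
  · split_ifs <;> omega
  · rw [mulVecLin_apply, mulVec_col, stairOp_mul_laurentBlock]

/-- The invertible matrix `P D^(-⌊m/2⌋)` shifts the Krylov exponents `0, …, m - 1` onto the Laurent
window. -/
lemma finrank_laurentSpace (m : ℕ) : Module.finrank ℂ (laurentSpace P D W m) =
    (blockKrylov (D : Matrix (Fin n) (Fin n) ℂ) W m).rank := by
  have key : ∀ (l : Fin m) (i : Fin k),
      (((P * D ^ (-((m / 2 : ℕ) : ℤ)) : unitaryGroup (Fin n) ℂ) : Matrix (Fin n) (Fin n) ℂ) *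
        blockKrylov (D : Matrix (Fin n) (Fin n) ℂ) W m).col (l, i) =
      (laurentBlock P D W (l - ((m / 2 : ℕ) : ℤ))).col i := by
    intro l i
    have h1 : (blockKrylov (D : Matrix (Fin n) (Fin n) ℂ) W m).col (l, i) =
        ((D : Matrix (Fin n) (Fin n) ℂ) ^ (l : ℕ) * W).col i := rfl
    have h2 : ((D ^ ((l : ℤ) - ((m / 2 : ℕ) : ℤ)) : unitaryGroup (Fin n) ℂ) :
        Matrix (Fin n) (Fin n) ℂ) = ((D ^ (-((m / 2 : ℕ) : ℤ)) : unitaryGroup (Fin n) ℂ) :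
        Matrix (Fin n) (Fin n) ℂ) * (D : Matrix (Fin n) (Fin n) ℂ) ^ (l : ℕ) := by
      rw [sub_eq_neg_add, _root_.zpow_add, zpow_natCast]; rfl
    calc _ = ((P * D ^ (-((m / 2 : ℕ) : ℤ)) : unitaryGroup (Fin n) ℂ) :
          Matrix (Fin n) (Fin n) ℂ) *ᵥ
            (blockKrylov (D : Matrix (Fin n) (Fin n) ℂ) W m).col (l, i) := by ext j; rfl
      _ = _ := by
        rw [h1, mulVec_col, laurentBlock, h2, UnitaryGroup.mul_val]
        simp only [Matrix.mul_assoc]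
  suffices hset : {x | ∃ z : ℤ, -((m / 2 : ℕ) : ℤ) ≤ z ∧ z < m - ((m / 2 : ℕ) : ℤ) ∧
      ∃ i, x = (laurentBlock P D W z).col i} = Set.range
      (((P * D ^ (-((m / 2 : ℕ) : ℤ)) : unitaryGroup (Fin n) ℂ) : Matrix (Fin n) (Fin n) ℂ) *
        blockKrylov (D : Matrix (Fin n) (Fin n) ℂ) W m).col by
    rw [← rank_mul_eq_right_of_isUnit_det
    ((P * D ^ (-((m / 2 : ℕ) : ℤ)) : unitaryGroup (Fin n) ℂ) : Matrix (Fin n) (Fin n) ℂ) _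
    (UnitaryGroup.det_isUnit _), rank_eq_finrank_span_cols, laurentSpace, hset]
  ext x
  constructor
  · rintro ⟨z, h1, h2, i, rfl⟩
    refine ⟨(⟨(z + ((m / 2 : ℕ) : ℤ)).toNat, by omega⟩, i), ?_⟩
    rw [key]
    congr 2
    simp only
    omega
  · rintro ⟨⟨l, i⟩, rfl⟩
    exact ⟨l - ((m / 2 : ℕ) : ℤ), by omega, by have := l.2; omega, i, key l i⟩

lemma rank_blockKrylov_le (m : ℕ) :
    (blockKrylov (D : Matrix (Fin n) (Fin n) ℂ) W m).rank ≤ min n (m * k) := by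
  refine le_min ?_ ?_
  · simpa using rank_le_card_height (blockKrylov (D : Matrix (Fin n) (Fin n) ℂ) W m)
  · simpa using rank_le_card_width (blockKrylov (D : Matrix (Fin n) (Fin n) ℂ) W m)

lemma leadingSpace_le_laurentSpace (hk : 0 < k)
    (hG : IsBlockCMV k ((P : Matrix (Fin n) (Fin n) ℂ) * (D : Matrix (Fin n) (Fin n) ℂ)ᴴ *
      (P : Matrix (Fin n) (Fin n) ℂ)ᴴ)) (hW : (P : Matrix (Fin n) (Fin n) ℂ) * W = firstCols n k)
    (m : ℕ) : leadingSpace n (m * k) ≤ laurentSpace P D W m := by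
  induction m with
  | zero =>
    intro x hx
    rw [zero_mul] at hx
    rw [eq_zero_of_mem_leadingSpace_zero hx]; exact zero_mem _
  | succ m ih =>
    rcases Nat.eq_zero_or_pos m with rfl | hm
    · refine leadingSpace_le fun q hq => ?_
      refine Submodule.subset_span ⟨0, by simp, by simp, ⟨q, by simpa using hq⟩, ?_⟩
      rw [laurentBlock, zpow_zero, UnitaryGroup.one_val, Matrix.one_mul, hW]
      ext i; simp [firstCols, Pi.single_apply, Fin.ext_iff]
    · intro x hx
      obtain ⟨t, ht, u, -, hu, rfl⟩ := exists_sub_stairOp_mem hk hG hm hx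
      exact add_mem (laurentSpace_mono P D W (Nat.le_succ m) (ih ht))
        (stairOp_mulVec_mem_laurentSpace P D W (ih hu))

lemma rank_blockKrylov_of_isBlockCMV (hk : 0 < k)
    (hG : IsBlockCMV k ((P : Matrix (Fin n) (Fin n) ℂ) * (D : Matrix (Fin n) (Fin n) ℂ)ᴴ *
      (P : Matrix (Fin n) (Fin n) ℂ)ᴴ)) (hW : (P : Matrix (Fin n) (Fin n) ℂ) * W = firstCols n k)
    (m : ℕ) : (blockKrylov (D : Matrix (Fin n) (Fin n) ℂ) W m).rank = min n (m * k) := by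
  refine le_antisymm (rank_blockKrylov_le D W m) ?_
  rw [← finrank_leadingSpace, ← finrank_laurentSpace P]
  exact Submodule.finrank_mono (leadingSpace_le_laurentSpace P D W hk hG hW m)

end Krylov

theorem krylovNondegenerate_of_isBlockCMV {n k : ℕ} (hk : 0 < k)
    {P D : Matrix (Fin n) (Fin n) ℂ} (hP : P ∈ unitaryGroup (Fin n) ℂ)
    (hD : D ∈ unitaryGroup (Fin n) ℂ) {U : Matrix (Fin n) (Fin k) ℂ}
    {U₁ : Matrix (Fin k) (Fin k) ℂ} (hG : IsBlockCMV k (P * Dᴴ * Pᴴ))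
    (hU : P * U = firstCols n k * U₁) : KrylovNondegenerate D U := by
  refine ⟨Pᴴ * firstCols n k, U₁, ?_, rank_blockKrylov_of_isBlockCMV ⟨P, hP⟩ ⟨D, hD⟩ _ hk hG ?_⟩
  · rw [Matrix.mul_assoc, ← hU, ← Matrix.mul_assoc, conjTranspose_mul_self_of_unitary hP,
      Matrix.one_mul]
  · show P * (Pᴴ * firstCols n k) = firstCols n k
    rw [← Matrix.mul_assoc, mul_conjTranspose_self_of_unitary hP, Matrix.one_mul]

lemma eq_firstCols_mul {n k : ℕ} (hkn : k < n) {X : Matrix (Fin n) (Fin k) ℂ}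
    (hX : ∀ j, X.col j ∈ leadingSpace n k) : ∃ X₁ : Matrix (Fin k) (Fin k) ℂ,
      X = firstCols n k * X₁ := by
  refine ⟨Matrix.of fun a j => X (Fin.castLE hkn.le a) j, ?_⟩
  ext i j
  by_cases hi : (i : ℕ) < k
  · rw [mul_apply, Finset.sum_eq_single ⟨i, hi⟩]
    · simp [firstCols]
    · intro b _ hb
      have : (i : ℕ) ≠ b := fun h => hb (Fin.ext h.symm)
      simp [firstCols, this]
    · simp
  · have h1 : ∀ a : Fin k, (i : ℕ) ≠ a := fun a => by have := a.2; omega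
    rw [show X i j = 0 from hX j i (by omega)]
    simp [mul_apply, firstCols, h1]

/-- Orthonormalizing the Laurent sequence puts its vectors in triangular position, and maximal rank
upgrades the inclusion of the first `m` Krylov blocks in the first `m` coordinate blocks to an
equality. -/
theorem exists_isBlockCMV {n k : ℕ} (hk : 0 < k) (hkn : k < n) {D : Matrix (Fin n) (Fin n) ℂ}
    (hD : D ∈ unitaryGroup (Fin n) ℂ) {U : Matrix (Fin n) (Fin k) ℂ}
    (h : KrylovNondegenerate D U) : ∃ P ∈ unitaryGroup (Fin n) ℂ,
      ∃ U₁ : Matrix (Fin k) (Fin k) ℂ, IsBlockCMV k (P * Dᴴ * Pᴴ) ∧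
        P * U = firstCols n k * U₁ := by
  obtain ⟨W, C, rfl, hrank⟩ := h
  let D' : unitaryGroup (Fin n) ℂ := ⟨D, hD⟩
  obtain ⟨H, hH, hprop⟩ := exists_unitary_adapted (n := n) (fun _ => ⊤) (fun _ _ _ => le_rfl)
    (fun q => (laurentBlock 1 D' W (stairExp (q / k))).col ⟨q % k, Nat.mod_lt _ hk⟩)
    (fun q hq => by simpa using hq) (fun _ _ => trivial)
  let P : unitaryGroup (Fin n) ℂ := ⟨Hᴴ, conjTranspose_mem_unitary hH⟩
  have hv : ∀ q, (laurentBlock P D' W (stairExp (q / k))).col ⟨q % k, Nat.mod_lt _ hk⟩ ∈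
      leadingSpace n (q + 1) := fun q => by
    rcases Nat.lt_or_ge q n with hq | hq
    · have := (hprop ⟨q, hq⟩).2.1
      rw [mulVec_col, laurentBlock, UnitaryGroup.one_val, Matrix.one_mul] at this
      exact this
    · rw [leadingSpace_eq_top (by omega)]; trivial
  obtain ⟨v, hvq⟩ : ∃ v : ℕ → Fin n → ℂ, ∀ q,
    v q = (laurentBlock P D' W (stairExp (q / k))).col ⟨q % k, Nat.mod_lt _ hk⟩ := ⟨_, fun _ => rfl⟩
  simp only [← hvq] at hv
  have hvc : ∀ c (i : Fin k), v (c * k + i) = (laurentBlock P D' W (stairExp c)).col i := by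
    intro c i
    have h1 : (c * k + i) / k = c := by
      rw [mul_comm, Nat.mul_add_div hk, Nat.div_eq_of_lt i.2, add_zero]
    have h2 : (c * k + i) % k = i := by
      rw [Nat.mul_add_mod_self_right, Nat.mod_eq_of_lt i.2]
    rw [hvq, h1]; congr 1; exact Fin.ext h2
  have hgen : ∀ m, ∀ S : Submodule ℂ (Fin n → ℂ), (∀ q < m * k, v q ∈ S) →
      laurentSpace P D' W m ≤ S := by
    intro m S hS
    refine Submodule.span_le.2 ?_
    rintro _ ⟨z, h1, h2, i, rfl⟩
    obtain ⟨c, hc, rfl⟩ : ∃ c < m, stairExp c = z := by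
      -- The position of `z` in the sequence `0, -1, 1, -2, 2, …`.
      refine ⟨if z < 0 then (-2 * z - 1).toNat else (2 * z).toNat, ?_, ?_⟩
      · split_ifs <;> omega
      · unfold stairExp; split_ifs <;> omega
    rw [← hvc]
    refine hS _ ?_
    have := Nat.mul_le_mul_right k (Nat.succ_le_of_lt hc)
    rw [Nat.succ_mul] at this
    have := i.2
    omega
  have hspace : ∀ m, laurentSpace P D' W m = leadingSpace n (m * k) := fun m =>
    Submodule.eq_of_le_of_finrank_eq
      (hgen m _ fun q hq => leadingSpace_mono n (by omega) (hv q))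
      (by rw [finrank_laurentSpace, finrank_leadingSpace]; exact hrank m)
  have hspan : ∀ m, leadingSpace n (m * k) ≤ Submodule.span ℂ (v '' Set.Iio (m * k)) := fun m => by
    rw [← hspace]
    exact hgen m _ fun q hq => Submodule.subset_span ⟨q, hq, rfl⟩
  set G := Hᴴ * Dᴴ * Hᴴᴴ with hGdef
  have hop : ∀ m, ∀ x ∈ leadingSpace n (m * k),
      stairOp G m *ᵥ x ∈ leadingSpace n ((m + 1) * k) := by
    intro m x hx
    rw [← hspace] at hx ⊢
    exact stairOp_mulVec_mem_laurentSpace P D' W hx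
  have hop2 : ∀ c, 1 ≤ c → ∀ x ∈ leadingSpace n ((c - 2) * k),
      stairOp G c *ᵥ x ∈ leadingSpace n (c * k) := by
    intro c hc x hx
    rcases Nat.lt_or_ge 2 c with h2 | h2
    · have hs : stairOp G c = stairOp G (c - 2) := by
        unfold stairOp
        rw [show (c - 2) % 2 = c % 2 by omega]
      rw [hs]
      exact leadingSpace_mono n (Nat.mul_le_mul_right k (by omega)) (hop (c - 2) x hx)
    · rw [show c - 2 = 0 by omega, zero_mul] at hx
      rw [eq_zero_of_mem_leadingSpace_zero hx, mulVec_zero]; exact zero_mem _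
  -- Two steps back in the exponent sequence is one step of `G` or `Gᴴ`; truncated subtraction also
  -- makes this right at `c = 1`, where `G` takes exponent `0` to `-1`. Columns keep their order,
  -- hence the triangular blocks.
  have hstep : ∀ c, 1 ≤ c → stairOp G c * laurentBlock P D' W (stairExp (c - 2)) =
      laurentBlock P D' W (stairExp c) := by
    intro c hc
    have := stairOp_mul_laurentBlock P D' W c (stairExp (c - 2))
    refine this.trans ?_
    congr 1
    unfold stairExp
    split_ifs <;> omega
  have hGu : G ∈ unitaryGroup (Fin n) ℂ := mul_mem (mul_mem (conjTranspose_mem_unitary hH)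
    (conjTranspose_mem_unitary hD)) (conjTranspose_mem_unitary (conjTranspose_mem_unitary hH))
  have hshape : HasBlockCMVShape k G := by
    refine hasBlockCMVShape_iff.2 ⟨hGu, fun m _ i q hq hi => ?_, fun c hc i q hq hi hlt => ?_⟩
    · have := hop m _ (single_mem_leadingSpace ((Nat.div_lt_iff_lt_mul hk).1 hq)) i
        ((Nat.le_div_iff_mul_le hk).1 hi)
      rwa [mulVec_single_apply] at this
    · have hmn : (c - 2 + 1) * k ≤ n := by
        have h1 := (Nat.le_div_iff_mul_le hk).1 hi.ge
        have h2 := Nat.mul_le_mul_right k (show c - 2 + 1 ≤ c by omega)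
        have := i.2
        omega
      have hqlt := (Nat.div_lt_iff_lt_mul hk).1 (Nat.lt_succ_of_le hq.le)
      have hmem := leadingSpace_le_span_of_triangular hmn v (fun p _ => hv p) (hspan (c - 2 + 1))
        (Nat.succ_le_of_lt hqlt) (single_mem_leadingSpace (Nat.lt_succ_self _))
      have hidiv := Nat.div_add_mod (i : ℕ) k
      have hqdiv := Nat.div_add_mod (q : ℕ) k
      rw [hi, mul_comm] at hidiv
      rw [hq, mul_comm] at hqdiv
      suffices hle : Submodule.span ℂ (v '' Set.Iio ((q : ℕ) + 1)) ≤
          (leadingSpace n (c * k + (q : ℕ) % k + 1)).comap (mulVecLin (stairOp G c)) by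
        have := hle hmem i (by omega)
        rwa [mulVecLin_apply, mulVec_single_apply] at this
      refine Submodule.span_le.2 ?_
      rintro _ ⟨p, hp, rfl⟩
      have hp' : p < q + 1 := hp
      show stairOp G c *ᵥ v p ∈ leadingSpace n (c * k + (q : ℕ) % k + 1)
      rcases Nat.lt_or_ge p ((c - 2) * k) with hpb | hpb
      · exact leadingSpace_mono n (by omega)
          (hop2 c hc _ (leadingSpace_mono n (Nat.succ_le_of_lt hpb) (hv p)))
      · have hpk : p / k = c - 2 := Nat.div_eq_of_lt_le hpb (by
          rw [Nat.succ_eq_add_one] at hqlt; omega)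
        have hpdiv := Nat.div_add_mod p k
        rw [hpk, mul_comm] at hpdiv
        rw [hvq, mulVec_col, hpk, hstep c hc, ← hvc]
        exact leadingSpace_mono n (by simp only; omega) (hv _)
  refine ⟨Hᴴ, P.2, ?_⟩
  have hW0 : ∀ j, (Hᴴ * W).col j ∈ leadingSpace n k := fun j => by
    have h1 := hvc 0 j
    have h2 : laurentBlock P D' W (stairExp 0) = Hᴴ * W := by
      show laurentBlock P D' W 0 = _
      rw [laurentBlock, zpow_zero, UnitaryGroup.one_val, Matrix.one_mul]
    rw [h2] at h1
    rw [← h1]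
    exact leadingSpace_mono n (by have := j.2; omega) (hv _)
  obtain ⟨W₁, hW₁⟩ := eq_firstCols_mul hkn hW0
  refine ⟨W₁ * C, isBlockCMV_iff.2 ⟨hshape, fun c hc => ?_⟩, ?_⟩
  · refine (fullRankBlock_iff hk (Nat.sub_le c 2) _).2 fun x => ?_
    have hx : (fun i : Fin n => if (i : ℕ) / k = c then x i else 0) ∈
        leadingSpace n ((c + 1) * k) := mem_leadingSpace_of_block hk fun i hi => if_neg hi
    -- Only the exponent `stairExp c` is new, so coordinates in block `c` can be produced from it
    -- alone, that is, by `S_c` acting on the Krylov block `c - 2`; the part of that block in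
    -- earlier coordinates is harmless by `hop2`.
    have hle : laurentSpace P D' W (c + 1) ≤ laurentSpace P D' W c ⊔
        LinearMap.range (mulVecLin (laurentBlock P D' W (stairExp c))) := by
      refine Submodule.span_le.2 ?_
      rintro _ ⟨z, h1, h2, i, rfl⟩
      by_cases hz : z = stairExp c
      · refine Submodule.mem_sup_right ⟨Pi.single i 1, ?_⟩
        rw [mulVecLin_apply, mulVec_single_one, hz]
      · refine Submodule.mem_sup_left (Submodule.subset_span ⟨z, ?_, ?_, i, rfl⟩) <;>
          (unfold stairExp at hz; split_ifs at hz <;> omega)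
    rw [← hspace] at hx
    obtain ⟨t, ht, _, ⟨a, rfl⟩, hta⟩ := Submodule.mem_sup.1 (hle hx)
    rw [hspace] at ht
    have hb : laurentBlock P D' W (stairExp (c - 2)) *ᵥ a ∈ leadingSpace n ((c - 2 + 1) * k) := by
      have hr : LinearMap.range (mulVecLin (laurentBlock P D' W (stairExp (c - 2)))) ≤
          leadingSpace n ((c - 2 + 1) * k) := by
        rw [range_mulVecLin]
        refine Submodule.span_le.2 ?_
        rintro _ ⟨i, rfl⟩
        rw [← hvc]
        exact leadingSpace_mono n (by have := i.2; rw [add_mul, one_mul]; omega) (hv _)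
      exact hr ⟨a, rfl⟩
    obtain ⟨y, hy, u, hu, hyu⟩ := exists_split_leadingSpace hk hb
    refine ⟨u, hu, fun i hi => ?_⟩
    have h3 : mulVecLin (laurentBlock P D' W (stairExp c)) a =
        stairOp G c *ᵥ y + stairOp G c *ᵥ u := by
      rw [mulVecLin_apply, ← hstep c hc, ← mulVec_mulVec, hyu, mulVec_add]
    have hi' : c * k ≤ i := (Nat.le_div_iff_mul_le hk).1 hi.ge
    have h4 := congrFun hta i
    rw [h3] at h4
    simp only [Pi.add_apply, if_pos hi] at h4
    rw [ht i hi', hop2 c hc y hy i hi', zero_add, zero_add] at h4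
    exact h4
  · rw [← Matrix.mul_assoc, hW₁, Matrix.mul_assoc]

/-! ### Closedness of the set of reducible pairs -/

lemma isCompact_unitaryGroup (n : ℕ) :
    IsCompact (unitaryGroup (Fin n) ℂ : Set (Matrix (Fin n) (Fin n) ℂ)) := by
  have hb : IsCompact (Set.pi Set.univ fun _ : Fin n => Set.pi Set.univ fun _ : Fin n =>
      Metric.closedBall (0 : ℂ) 1) :=
    isCompact_univ_pi fun _ => isCompact_univ_pi fun _ => isCompact_closedBall _ _
  refine IsCompact.of_isClosed_subset hb ?_ fun M hM i _ j _ => ?_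
  · have : (unitaryGroup (Fin n) ℂ : Set (Matrix (Fin n) (Fin n) ℂ)) = {M | M * Mᴴ = 1} := by
      ext M; exact mem_unitaryGroup_iff
    rw [this]
    exact isClosed_eq (by fun_prop) continuous_const
  · rw [mem_closedBall_zero_iff]
    exact entry_norm_bound_of_unitary hM i j

instance compactSpace_unitaryGroup (n : ℕ) : CompactSpace (unitaryGroup (Fin n) ℂ) :=
  isCompact_iff_compactSpace.1 (isCompact_unitaryGroup n)

lemma isClosed_mem_unitaryGroup {X : Type*} [TopologicalSpace X] {n : ℕ}
    {f : X → Matrix (Fin n) (Fin n) ℂ} (hf : Continuous f) :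
    IsClosed {x | f x ∈ unitaryGroup (Fin n) ℂ} :=
  (isCompact_unitaryGroup n).isClosed.preimage hf

lemma isClosed_hasBlockCMVShape {X : Type*} [TopologicalSpace X] {n k : ℕ}
    {f : X → Matrix (Fin n) (Fin n) ℂ} (hf : Continuous f) :
    IsClosed {x | HasBlockCMVShape k (f x)} := by
  have h : {x | HasBlockCMVShape k (f x)} = {x | f x ∈ unitaryGroup (Fin n) ℂ} ∩
      ({x | ∀ (m : ℕ) (i q : Fin n), (1 ≤ m ∧ (q : ℕ) / k < m ∧ m < (i : ℕ) / k) →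
        stairOp (f x) m i q = 0} ∩
      {x | ∀ (c : ℕ) (i q : Fin n), (1 ≤ c ∧ (q : ℕ) / k = c - 2 ∧ (i : ℕ) / k = c ∧
        (q : ℕ) % k < (i : ℕ) % k) → stairOp (f x) c i q = 0}) := by
    ext x
    simp only [Set.mem_ofPred_eq, Set.mem_inter_iff, hasBlockCMVShape_iff, and_imp]
    exact and_congr_right fun _ => and_congr
      ⟨fun h m i q hm => h m hm i q, fun h m hm i q => h m i q hm⟩
      ⟨fun h m i q hm => h m hm i q, fun h m hm i q => h m i q hm⟩
  have hop : ∀ m, Continuous fun x => stairOp (f x) m := fun m => by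
    unfold stairOp
    split_ifs
    · exact hf
    · exact hf.matrix_conjTranspose
  rw [h]
  refine (isClosed_mem_unitaryGroup hf).inter (IsClosed.inter ?_ ?_) <;>
  · simp only [Set.ofPred_forall]
    exact isClosed_iInter fun a => isClosed_iInter fun i => isClosed_iInter fun j =>
      isClosed_iInter fun _ => isClosed_eq ((hop a).matrix_elem i j) continuous_const

lemma isClosed_upperTriBlock {X : Type*} [TopologicalSpace X] {n k a b : ℕ}
    {f : X → Matrix (Fin n) (Fin n) ℂ} (hf : Continuous f) :
    IsClosed {x | UpperTriBlock k (f x) a b} := by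
  unfold UpperTriBlock
  simp only [Set.ofPred_forall]
  exact isClosed_iInter fun i => isClosed_iInter fun j => isClosed_iInter fun _ =>
    isClosed_iInter fun _ => isClosed_iInter fun _ =>
      isClosed_eq (hf.matrix_elem i j) continuous_const

lemma isClosed_lowerTriBlock {X : Type*} [TopologicalSpace X] {n k a b : ℕ}
    {f : X → Matrix (Fin n) (Fin n) ℂ} (hf : Continuous f) :
    IsClosed {x | LowerTriBlock k (f x) a b} := by
  simp only [← upperTriBlock_conjTranspose]
  exact isClosed_upperTriBlock hf.matrix_conjTranspose

lemma isClosed_hasCMVFactorShape {X : Type*} [TopologicalSpace X] {n k : ℕ}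
    {f g₁ g₂ : X → Matrix (Fin n) (Fin n) ℂ} (hf : Continuous f) (hg₁ : Continuous g₁)
    (hg₂ : Continuous g₂) : IsClosed {x | HasCMVFactorShape k (f x) (g₁ x) (g₂ x)} := by
  have h : {x | HasCMVFactorShape k (f x) (g₁ x) (g₂ x)} = {x | f x = g₁ x * g₂ x ∧
      g₁ x ∈ unitaryGroup (Fin n) ℂ ∧ g₂ x ∈ unitaryGroup (Fin n) ℂ ∧
      (∀ i j : Fin n, ¬ ((i : ℕ) / k) / 2 = ((j : ℕ) / k) / 2 → g₁ x i j = 0) ∧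
      (∀ i j : Fin n, ¬ ((i : ℕ) / k + 1) / 2 = ((j : ℕ) / k + 1) / 2 → g₂ x i j = 0) ∧
      (∀ i j : Fin n, (i : ℕ) < k → (j : ℕ) < k →
        g₂ x i j = (1 : Matrix (Fin n) (Fin n) ℂ) i j) ∧
      (∀ p, UpperTriBlock k (g₁ x) (2 * p + 1) (2 * p)) ∧
      (∀ p, LowerTriBlock k (g₁ x) (2 * p) (2 * p + 1)) ∧
      (∀ p, UpperTriBlock k (g₂ x) (2 * p + 2) (2 * p + 1)) ∧
      (∀ p, LowerTriBlock k (g₂ x) (2 * p + 1) (2 * p + 2))} := by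
    ext x
    constructor
    · rintro ⟨h1, h2, h3, h4, h5, h6, h7, h8, h9, h10⟩
      exact ⟨h1, h2, h3, fun i j => not_imp_comm.1 (h4 i j), fun i j => not_imp_comm.1 (h5 i j),
        h6, h7, h8, h9, h10⟩
    · rintro ⟨h1, h2, h3, h4, h5, h6, h7, h8, h9, h10⟩
      exact ⟨h1, h2, h3, fun i j => not_imp_comm.1 (h4 i j), fun i j => not_imp_comm.1 (h5 i j),
        h6, h7, h8, h9, h10⟩
  rw [h]
  simp only [Set.ofPred_and]
  refine (isClosed_eq hf (hg₁.matrix_mul hg₂)).inter <| (isClosed_mem_unitaryGroup hg₁).inter <|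
    (isClosed_mem_unitaryGroup hg₂).inter <| IsClosed.inter ?_ <| IsClosed.inter ?_ <|
    IsClosed.inter ?_ <| IsClosed.inter ?_ <| IsClosed.inter ?_ <| IsClosed.inter ?_ ?_
  · simp only [Set.ofPred_forall]
    exact isClosed_iInter fun i => isClosed_iInter fun j => isClosed_iInter fun _ =>
      isClosed_eq (hg₁.matrix_elem i j) continuous_const
  · simp only [Set.ofPred_forall]
    exact isClosed_iInter fun i => isClosed_iInter fun j => isClosed_iInter fun _ =>
      isClosed_eq (hg₂.matrix_elem i j) continuous_const
  · simp only [Set.ofPred_forall]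
    exact isClosed_iInter fun i => isClosed_iInter fun j => isClosed_iInter fun _ =>
      isClosed_iInter fun _ => isClosed_eq (hg₂.matrix_elem i j) continuous_const
  · simp only [Set.ofPred_forall]; exact isClosed_iInter fun p => isClosed_upperTriBlock hg₁
  · simp only [Set.ofPred_forall]; exact isClosed_iInter fun p => isClosed_lowerTriBlock hg₁
  · simp only [Set.ofPred_forall]; exact isClosed_iInter fun p => isClosed_upperTriBlock hg₂
  · simp only [Set.ofPred_forall]; exact isClosed_iInter fun p => isClosed_lowerTriBlock hg₂

/-- The pairs `(D, U)` that can be reduced to block CMV shape with a CMV factorization shape. -/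
def reduciblePairs (n k : ℕ) : Set (Matrix (Fin n) (Fin n) ℂ × Matrix (Fin n) (Fin k) ℂ) :=
  {x | ∃ P G₁ G₂ : unitaryGroup (Fin n) ℂ,
    HasBlockCMVShape k ((P : Matrix (Fin n) (Fin n) ℂ) * x.1ᴴ * (P : Matrix (Fin n) (Fin n) ℂ)ᴴ) ∧
    (∀ j, ((P : Matrix (Fin n) (Fin n) ℂ) * x.2).col j ∈ leadingSpace n k) ∧
    HasCMVFactorShape k
      ((P : Matrix (Fin n) (Fin n) ℂ) * x.1ᴴ * (P : Matrix (Fin n) (Fin n) ℂ)ᴴ) G₁ G₂}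

/-- All conditions are closed in `(D, U, P, G₁, G₂)`, and the projection forgetting the three
compact unitary variables is a closed map. Stating `P U = E U₁` as vanishing rows avoids the
noncompact variable `U₁`. -/
lemma isClosed_reduciblePairs (n k : ℕ) : IsClosed (reduciblePairs n k) := by
  let S : Set ((Matrix (Fin n) (Fin n) ℂ × Matrix (Fin n) (Fin k) ℂ) ×
      unitaryGroup (Fin n) ℂ × unitaryGroup (Fin n) ℂ × unitaryGroup (Fin n) ℂ) := {z | HasBlockCMVShape k ((z.2.1 : Matrix (Fin n) (Fin n) ℂ) * z.1.1ᴴ *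
      (z.2.1 : Matrix (Fin n) (Fin n) ℂ)ᴴ) ∧
    (∀ j, ((z.2.1 : Matrix (Fin n) (Fin n) ℂ) * z.1.2).col j ∈ leadingSpace n k) ∧
    HasCMVFactorShape k ((z.2.1 : Matrix (Fin n) (Fin n) ℂ) * z.1.1ᴴ *
      (z.2.1 : Matrix (Fin n) (Fin n) ℂ)ᴴ) z.2.2.1 z.2.2.2}
  have hP : Continuous fun z : (Matrix (Fin n) (Fin n) ℂ × Matrix (Fin n) (Fin k) ℂ) ×
      unitaryGroup (Fin n) ℂ × unitaryGroup (Fin n) ℂ × unitaryGroup (Fin n) ℂ => (z.2.1 : Matrix (Fin n) (Fin n) ℂ) := by fun_prop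
  have hD : Continuous fun z : (Matrix (Fin n) (Fin n) ℂ × Matrix (Fin n) (Fin k) ℂ) ×
      unitaryGroup (Fin n) ℂ × unitaryGroup (Fin n) ℂ × unitaryGroup (Fin n) ℂ => z.1.1 := by fun_prop
  have hU : Continuous fun z : (Matrix (Fin n) (Fin n) ℂ × Matrix (Fin n) (Fin k) ℂ) ×
      unitaryGroup (Fin n) ℂ × unitaryGroup (Fin n) ℂ × unitaryGroup (Fin n) ℂ => z.1.2 := by fun_prop
  have hG := (hP.matrix_mul hD.matrix_conjTranspose).matrix_mul hP.matrix_conjTranspose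
  have hS : IsClosed S := by
    refine (isClosed_hasBlockCMVShape hG).inter (IsClosed.inter ?_
      (isClosed_hasCMVFactorShape hG (by fun_prop) (by fun_prop)))
    show IsClosed {z : (Matrix (Fin n) (Fin n) ℂ × Matrix (Fin n) (Fin k) ℂ) ×
      unitaryGroup (Fin n) ℂ × unitaryGroup (Fin n) ℂ × unitaryGroup (Fin n) ℂ |
      ∀ j, ((z.2.1 : Matrix (Fin n) (Fin n) ℂ) * z.1.2).col j ∈ leadingSpace n k}
    simp only [mem_leadingSpace, Set.ofPred_forall]
    exact isClosed_iInter fun j => isClosed_iInter fun i => isClosed_iInter fun _ =>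
      isClosed_eq ((hP.matrix_mul hU).matrix_elem i j) continuous_const
  have himg : reduciblePairs n k = Prod.fst '' S := by
    ext x
    constructor
    · rintro ⟨P, G₁, G₂, h⟩
      exact ⟨(x, P, G₁, G₂), h, rfl⟩
    · rintro ⟨⟨x, P, G₁, G₂⟩, h, rfl⟩
      exact ⟨P, G₁, G₂, h⟩
  rw [himg]
  exact isClosedMap_fst_of_compactSpace _ hS

lemma mem_reduciblePairs {n k : ℕ} (hk : 0 < k) (hkn : k < n) {D : Matrix (Fin n) (Fin n) ℂ}
    (hD : D ∈ unitaryGroup (Fin n) ℂ) {U : Matrix (Fin n) (Fin k) ℂ}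
    (h : KrylovNondegenerate D U) : (D, U) ∈ reduciblePairs n k := by
  obtain ⟨P, hP, U₁, hG, hU⟩ := exists_isBlockCMV hk hkn hD h
  obtain ⟨G₁, G₂, hF⟩ := exists_isCMVFactorization hk hG
  refine ⟨⟨P, hP⟩, ⟨G₁, hF.unitary₁⟩, ⟨G₂, hF.unitary₂⟩, hG.toHasBlockCMVShape, fun j i hi => ?_,
    hF.toHasCMVFactorShape⟩
  show (P * U) i j = 0
  rw [hU, mul_apply]
  refine Finset.sum_eq_zero fun a _ => ?_
  have : (i : ℕ) ≠ a := by have := a.2; omega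
  simp [firstCols, this]

/-! ### Density of nondegenerate pairs -/

/-- The first `n` columns of the block Krylov sequence `W, D W, D² W, …`. -/
def krylovSquare {n k : ℕ} (hk : 0 < k) (D : Matrix (Fin n) (Fin n) ℂ)
    (W : Matrix (Fin n) (Fin k) ℂ) : Matrix (Fin n) (Fin n) ℂ :=
  Matrix.of fun i q => (D ^ ((q : ℕ) / k) * W) i ⟨(q : ℕ) % k, Nat.mod_lt _ hk⟩

/-- The first `min n (m * k)` columns of the invertible square matrix are independent and occur
among those of the `m`-th block Krylov matrix. -/
lemma krylovNondegenerate_of_det_ne_zero {n k : ℕ} (hk : 0 < k) {D : Matrix (Fin n) (Fin n) ℂ}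
    {W : Matrix (Fin n) (Fin k) ℂ} (h : (krylovSquare hk D W).det ≠ 0) :
    KrylovNondegenerate D W := by
  refine ⟨W, 1, (Matrix.mul_one W).symm, fun m => le_antisymm (le_min ?_ ?_) ?_⟩
  · simpa using rank_le_card_height (blockKrylov D W m)
  · simpa using rank_le_card_width (blockKrylov D W m)
  · have hr : min n (m * k) ≤ n := min_le_left _ _
    have hdiv : ∀ q : Fin (min n (m * k)), (q : ℕ) / k < m := fun q =>
      (Nat.div_lt_iff_lt_mul hk).2 (q.2.trans_le (min_le_right _ _))
    have hli := (linearIndependent_cols_of_det_ne_zero h).comp (Fin.castLE hr)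
      (Fin.castLE_injective hr)
    have h1 := finrank_span_eq_card hli
    rw [Fintype.card_fin] at h1
    refine le_trans (le_of_eq ?_) (rank_submatrix_le (blockKrylov D W m) id
      (fun q : Fin (min n (m * k)) => ((⟨(q : ℕ) / k, hdiv q⟩ : Fin m),
        (⟨(q : ℕ) % k, Nat.mod_lt _ hk⟩ : Fin k))))
    rw [rank_eq_finrank_span_cols]
    exact h1.symm

/-- A bijective reindexing of the exponents `q / k + a (q % k)`. -/
lemma exists_perm_exponents {n k : ℕ} (hk : 0 < k) : ∃ (a : ℕ → ℕ) (σ : Equiv.Perm (Fin n)),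
    ∀ q, (σ q : ℕ) = (q : ℕ) / k + a ((q : ℕ) % k) := by
  -- `a c` counts the `q < n` with `q % k < c`, so the residue classes are laid out one after
  -- another.
  obtain ⟨a, ha⟩ : ∃ a : ℕ → ℕ, ∀ c, a c = c * (n / k) + min c (n % k) := ⟨_, fun _ => rfl⟩
  have hn := Nat.div_add_mod n k
  have hlt : ∀ q : Fin n, (q : ℕ) / k + a ((q : ℕ) % k) < a ((q : ℕ) % k + 1) := by
    intro q
    have hq := Nat.div_add_mod (q : ℕ) k
    have hle : (q : ℕ) / k ≤ n / k := Nat.div_le_div_right q.2.le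
    simp only [ha, add_mul, one_mul]
    rcases hle.lt_or_eq with h | h
    · have : min ((q : ℕ) % k) (n % k) ≤ min ((q : ℕ) % k + 1) (n % k) :=
        min_le_min_right _ (Nat.le_succ _)
      omega
    · have hr : (q : ℕ) % k < n % k := by
        have := q.2; rw [h] at hq; omega
      rw [min_eq_left hr.le, min_eq_left (Nat.succ_le_of_lt hr)]
      omega
  have hmono : Monotone a := fun c c' hcc => by
    rw [ha, ha]; exact Nat.add_le_add (Nat.mul_le_mul_right _ hcc) (min_le_min_right _ hcc)
  have hak : a k = n := by
    rw [ha, min_eq_right (Nat.mod_lt n hk).le, hn]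
  have hbd : ∀ q : Fin n, (q : ℕ) / k + a ((q : ℕ) % k) < n := fun q =>
    (hlt q).trans_le ((hmono (Nat.succ_le_of_lt (Nat.mod_lt _ hk))).trans_eq hak)
  let s : Fin n → Fin n := fun q => ⟨_, hbd q⟩
  have hinj : Function.Injective s := by
    intro q q' h
    have h' : (q : ℕ) / k + a ((q : ℕ) % k) = (q' : ℕ) / k + a ((q' : ℕ) % k) :=
      congrArg Fin.val h
    have h1 := hlt q
    have h2 := hlt q'
    have h3 := Nat.zero_le ((q : ℕ) / k)
    have h4 := Nat.zero_le ((q' : ℕ) / k)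
    have hmod : (q : ℕ) % k = (q' : ℕ) % k := by
      rcases Nat.lt_trichotomy ((q : ℕ) % k) ((q' : ℕ) % k) with hc | hc | hc
      · have := hmono (Nat.succ_le_of_lt hc); simp only [Nat.succ_eq_add_one] at this; omega
      · exact hc
      · have := hmono (Nat.succ_le_of_lt hc); simp only [Nat.succ_eq_add_one] at this; omega
    rw [hmod] at h'
    refine Fin.ext ?_
    rw [← Nat.div_add_mod (q : ℕ) k, ← Nat.div_add_mod (q' : ℕ) k, hmod, Nat.add_right_cancel h']
  exact ⟨a, Equiv.ofBijective s (Finite.injective_iff_bijective.1 hinj), fun q => rfl⟩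

/-- With entries `d i ^ a c` in `W`, the Krylov columns are the powers of `d` in permuted order: a
Vandermonde matrix. -/
lemma exists_krylovSquare_det_ne_zero {n k : ℕ} (hk : 0 < k) {d : Fin n → ℂ}
    (hd : Function.Injective d) :
    ∃ W : Matrix (Fin n) (Fin k) ℂ, (krylovSquare hk (diagonal d) W).det ≠ 0 := by
  obtain ⟨a, σ, hσ⟩ := exists_perm_exponents (n := n) hk
  refine ⟨Matrix.of fun i c => d i ^ a c, ?_⟩
  have h : krylovSquare hk (diagonal d) (Matrix.of fun i c => d i ^ a c) =
      (vandermonde d).submatrix id σ := by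
    ext i q
    rw [krylovSquare, of_apply, diagonal_pow, diagonal_mul, submatrix_apply, vandermonde_apply, hσ,
      pow_add]
    rfl
  rw [h, det_permute']
  refine mul_ne_zero ?_ (det_vandermonde_ne_zero_iff.2 hd)
  rcases Int.units_eq_one_or (Equiv.Perm.sign σ) with h | h <;> simp [h]

/-- On the line from a good `W` to `U` the Krylov determinant is a polynomial, nonzero at `s = 0`.
Off its finitely many roots the pair is reducible, and closedness carries this to `s = 1`. -/
lemma mem_reduciblePairs_of_injective {n k : ℕ} (hk : 0 < k) (hkn : k < n) {d : Fin n → ℂ}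
    (hd : Function.Injective d) (hD : diagonal d ∈ unitaryGroup (Fin n) ℂ)
    (U : Matrix (Fin n) (Fin k) ℂ) : (diagonal d, U) ∈ reduciblePairs n k := by
  obtain ⟨W, hW⟩ := exists_krylovSquare_det_ne_zero hk hd
  let A := krylovSquare hk (diagonal d) W
  let B := krylovSquare hk (diagonal d) (U - W)
  let p : Polynomial ℂ := det ((Polynomial.X : Polynomial ℂ) • B.map Polynomial.C + A.map Polynomial.C)
  have hp0 : p ≠ 0 := fun h => hW (by
    have := Polynomial.coeff_det_X_add_C_zero B A
    change p.coeff 0 = A.det at this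
    rw [← show A.det = (krylovSquare hk (diagonal d) W).det from rfl, ← this, h,
      Polynomial.coeff_zero])
  have hpe : ∀ s : ℂ, p.eval s = (krylovSquare hk (diagonal d) (W + s • (U - W))).det := by
    intro s
    rw [← Polynomial.coe_evalRingHom, RingHom.map_det]
    congr 1
    ext i q
    simp [A, B, krylovSquare, Matrix.mul_add, add_comm, mul_comm _ s]
  let f : ℂ → Matrix (Fin n) (Fin n) ℂ × Matrix (Fin n) (Fin k) ℂ :=
    fun s => (diagonal d, W + s • (U - W))
  have hf : Continuous f := by fun_prop
  have hdense : Dense {s : ℂ | p.IsRoot s}ᶜ :=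
    (Polynomial.finite_setOfPred_isRoot hp0).countable.dense_compl ℂ
  have hsub : closure {s : ℂ | p.IsRoot s}ᶜ ⊆ f ⁻¹' reduciblePairs n k :=
    closure_minimal (fun s hs => mem_reduciblePairs hk hkn hD
      (krylovNondegenerate_of_det_ne_zero hk (by rw [← hpe]; exact hs)))
      ((isClosed_reduciblePairs n k).preimage hf)
  have h1 : f 1 ∈ reduciblePairs n k := hsub (by rw [hdense.closure_eq]; trivial)
  simpa [f] using h1

lemma diagonal_mem_unitaryGroup_iff {n : ℕ} {d : Fin n → ℂ} :
    diagonal d ∈ unitaryGroup (Fin n) ℂ ↔ ∀ i, ‖d i‖ = 1 := by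
  rw [mem_unitaryGroup_iff, star_eq_conjTranspose, diagonal_conjTranspose, diagonal_mul_diagonal,
    diagonal_eq_one, funext_iff]
  refine forall_congr' fun i => ?_
  rw [Pi.star_apply, Pi.one_apply, Complex.star_def, Complex.mul_conj, Complex.normSq_eq_norm_sq]
  norm_cast
  rw [pow_eq_one_iff_of_nonneg (norm_nonneg _) two_ne_zero]

open Filter Topology in
-- Rotating the `i`-th diagonal entry by the angle `s * i` separates coinciding entries for small `s
-- ≠ 0`; let `s → 0` in the closed set.
theorem mem_reduciblePairs_of_isDiag {n k : ℕ} (hk : 0 < k) (hkn : k < n)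
    {D : Matrix (Fin n) (Fin n) ℂ} (hdiag : D.IsDiag) (hD : D ∈ unitaryGroup (Fin n) ℂ)
    (U : Matrix (Fin n) (Fin k) ℂ) : (D, U) ∈ reduciblePairs n k := by
  obtain ⟨d, rfl⟩ : ∃ d, D = diagonal d := ⟨D.diag, hdiag.diagonal_diag.symm⟩
  rw [diagonal_mem_unitaryGroup_iff] at hD
  let e : ℝ → Fin n → ℂ := fun s i => d i * Complex.exp ((s * (i : ℕ) : ℂ) * Complex.I)
  have he : Continuous e := by fun_prop
  have hnorm : ∀ s i, ‖e s i‖ = 1 := fun s i => by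
    simp only [e, norm_mul, hD i, one_mul]
    exact_mod_cast Complex.norm_exp_ofReal_mul_I (s * (i : ℕ))
  have hinj : ∀ᶠ s in 𝓝[≠] (0 : ℝ), Function.Injective (e s) := by
    have hne : ∀ i j : Fin n, i ≠ j → ∀ᶠ s in 𝓝[≠] (0 : ℝ), e s i ≠ e s j := by
      intro i j hij
      have hder : ∀ i : Fin n, HasDerivAt (fun s => e s i) (d i * ((i : ℕ) * Complex.I)) 0 := by
        intro i
        have h1 : HasDerivAt (fun s : ℝ => (s * (i : ℕ) : ℂ) * Complex.I)
            ((i : ℕ) * Complex.I) 0 := by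
          simpa using (((hasDerivAt_id (0 : ℝ)).ofReal_comp).mul_const ((i : ℕ) : ℂ)).mul_const
            Complex.I
        simpa using h1.cexp.const_mul (d i)
      -- The derivatives at `0` have moduli `i` and `j`, so the difference of the two entries has
      -- nonzero derivative and avoids `0` near `s = 0`.
      have h2 := ((hder i).sub (hder j)).eventually_ne (c := 0) (fun h => by
        have h3 := congrArg norm (sub_eq_zero.1 h)
        simp only [norm_mul, hD, one_mul, Complex.norm_I, mul_one, Complex.norm_natCast] at h3
        exact hij (Fin.ext (by exact_mod_cast h3)))
      filter_upwards [h2] with s hs h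
      exact hs (sub_eq_zero.2 h)
    have hall : ∀ᶠ s in 𝓝[≠] (0 : ℝ), ∀ i j : Fin n, i ≠ j → e s i ≠ e s j := by
      simp only [eventually_all]
      exact hne
    filter_upwards [hall] with s hs i j h
    by_contra hij
    exact hs i j hij h
  have htend : Tendsto (fun s => (diagonal (e s), U)) (𝓝[≠] (0 : ℝ)) (𝓝 (diagonal d, U)) := by
    have hc : Continuous fun s => (diagonal (e s), U) := by fun_prop
    have h0 : e 0 = d := by ext i; simp [e]
    have := hc.tendsto 0
    rw [h0] at this
    exact this.mono_left nhdsWithin_le_nhds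
  refine (isClosed_reduciblePairs n k).mem_of_tendsto htend ?_
  filter_upwards [hinj] with s hs
  exact mem_reduciblePairs_of_injective hk hkn hs (diagonal_mem_unitaryGroup_iff.2 (hnorm s)) U

theorem theorem2p5 (n k : ℕ) (hk : 0 < k) (hkn : k < n)
    (A D : Matrix (Fin n) (Fin n) ℂ) (U V : Matrix (Fin n) (Fin k) ℂ)
    (hdiag : D.IsDiag) (hunit : D ∈ Matrix.unitaryGroup (Fin n) ℂ) (hA : A = D + U * Vᴴ) :
    -- Every `(D, U, V)`: reduction, factorization and LFR form, the triangular blocks being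
    -- possibly singular.
    (∃ P ∈ Matrix.unitaryGroup (Fin n) ℂ, ∃ U₁ : Matrix (Fin k) (Fin k) ℂ,
      ∃ G₁ G₂ : Matrix (Fin n) (Fin n) ℂ,
        HasBlockCMVShape k (P * Dᴴ * Pᴴ) ∧ P * U = firstCols n k * U₁ ∧
        HasCMVFactorShape k (P * Dᴴ * Pᴴ) G₁ G₂ ∧
        IsLFR k (P * A * Pᴴ) G₂ᴴ (1 + firstCols n k * (U₁ * (P * V)ᴴ * G₁)) G₁ᴴ) ∧
    -- The triangular blocks can be taken nonsingular exactly when there is no breakdown.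
    ((∃ P ∈ Matrix.unitaryGroup (Fin n) ℂ, ∃ U₁ : Matrix (Fin k) (Fin k) ℂ,
        IsBlockCMV k (P * Dᴴ * Pᴴ) ∧ P * U = firstCols n k * U₁) ↔ KrylovNondegenerate D U) ∧
    -- Each reduction to block CMV form has a CMV factorization, and each such factorization gives
    -- an LFR representation.
    (∀ P ∈ Matrix.unitaryGroup (Fin n) ℂ, ∀ U₁ : Matrix (Fin k) (Fin k) ℂ,
      IsBlockCMV k (P * Dᴴ * Pᴴ) → P * U = firstCols n k * U₁ →
        (∃ G₁ G₂ : Matrix (Fin n) (Fin n) ℂ, IsCMVFactorization k (P * Dᴴ * Pᴴ) G₁ G₂) ∧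
        ∀ G₁ G₂ : Matrix (Fin n) (Fin n) ℂ, IsCMVFactorization k (P * Dᴴ * Pᴴ) G₁ G₂ →
          IsLFR k (P * A * Pᴴ) G₂ᴴ (1 + firstCols n k * (U₁ * (P * V)ᴴ * G₁)) G₁ᴴ) := by
  refine ⟨?_, ⟨?_, fun h => exists_isBlockCMV hk hkn hunit h⟩, fun P hP U₁ hG hU =>
    ⟨exists_isCMVFactorization hk hG, fun G₁ G₂ hF => hF.toHasCMVFactorShape.isLFR hk hA hU⟩⟩
  · obtain ⟨P, G₁, G₂, hG, hU, hF⟩ := mem_reduciblePairs_of_isDiag hk hkn hdiag hunit U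
    obtain ⟨U₁, hU₁⟩ := eq_firstCols_mul hkn hU
    exact ⟨P, P.2, U₁, G₁, G₂, hG, hU₁, hF, hF.isLFR hk hA hU₁⟩
  · rintro ⟨P, hP, U₁, hG, hU⟩
    exact krylovNondegenerate_of_isBlockCMV hk hP hunit hG hU
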